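/- **Setting.** Let $\mathcal V,\mathcal W,\mathcal H_{\mathcal W}$ be real Hilbert spaces, $\mathcal W$ continuously and densely embedded in $\mathcal H_{\mathcal W}$, with duals $\mathcal V',\mathcal W'$. Let $a$ on $\mathcal V$, $b$ on $\mathcal W$, $c$ on $\mathcal H_{\mathcal W}$ be bounded symmetric coercive bilinear forms and $d:\mathcal V\times\mathcal H_{\mathcal W}\to\mathbb R$ a bounded bilinear form, with positive constants such that $a(v,v)\ge c_a\|v\|_{\mathcal V}^2$, $b(w,w)\ge c_b\|w\|_{\mathcal W}^2$, $c(x,x)\ge c_c\|x\|_{\mathcal H_{\mathcal W}}^2$ and $d(v,x)\le C_d\|v\|_{\mathcal V}\|x\|_{\mathcal H_{\mathcal W}}$. Let $\mathcal A,\mathcal B,\mathcal C,\mathcal D$ be the operators of $a,b,c,d$, let $\mathcal M:=\mathcal D\mathcal A^{-1}\mathcal D^\star$, and let $\omega:=C_d^2/(c_ac_c)$. Let $q\in\{4,5,6\}$ and let $$\alpha(\zeta)=\sum_{j=1}^q\tfrac1j\zeta^{q-j}(\zeta-1)^j,\quad \beta(\zeta)=\zeta^q,\quad \gamma(\zeta)=\zeta^q-(\zeta-1)^q=\sum_{i=0}^{q-1}\gamma_i\zeta^i,$$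 $$\alpha\beta=\sum_{i=0}^{2q}\tilde\alpha_i\zeta^i,\qquad \alpha\gamma=\sum_{i=0}^{2q-1}\hat\alpha_i\zeta^i .$$ Let $T>0$, $N\ge1$, $\tau=T/N$, $t_n=n\tau$. **Scheme.** Given starting values $p^0,\dots,p^{q-1}\in\mathcal W$, define $p^{-1},\dots,p^{-q}\in\mathcal W$ by $\sum_{i=0}^{q-1}\gamma_ip^{n-q+i}=p^n$, $n=q-1,\dots,0$. The implicit–explicit $q$-step BDF approximations $p^n\in\mathcal W$ satisfy, in $\mathcal W'$, $$\mathcal C\sum_{i=0}^{2q}\tilde\alpha_ip^{n-2q+i}+\mathcal M\sum_{i=0}^{2q-1}\hat\alpha_ip^{n-2q+i}+\tau\mathcal Bp^n=\tau g(t_n)-\mathcal D\mathcal A^{-1}\sum_{i=0}^{2q}\tilde\alpha_if(t_{n-2q+i}),\quad n=q,\dots,N$$ (only values of $f$ on $[0,T]$ enter, since $\tilde\alpha_i=0$ for $i<q$). **Delay equation.** Let $\mathfrak p:[-q\tau,T]\to\mathcal W$ satisfy, in $\mathcal W'$, $$\mathcal C\mathfrak p_t(t)+\mathcal M\sum_{j=0}^{q-1}\gamma_j\mathfrak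 p_t(t-q\tau+j\tau)+\mathcal B\mathfrak p(t)=g(t)-\mathcal D\mathcal A^{-1}f_t(t),\quad t\in(0,T],$$ where $f:[0,T]\to\mathcal V'$ and $g:[0,T]\to\mathcal W'$, with history values $\mathfrak p(t_{-\ell})=p^{-\ell}$, $\ell=0,\dots,q$. **Theorem.** Assume $\omega\le 1/(2^q-1)$ and let $K\ge0$. There is a constant $C>0$, depending only on $q$, $T$, $K$ and the spaces and bilinear forms (with their constants), and in particular not on $N$, $\tau$, $n$, the starting values or the solutions, such that, whenever $\mathfrak p\in W^{q+1,\infty}((-q\tau,T);\mathcal H_{\mathcal W})$ and $f\in W^{q+1,\infty}((0,T);\mathcal V')$ with $$\|\mathfrak p^{(q+1)}\|_{L^\infty((-q\tau,T);\mathcal H_{\mathcal W})}\le K,\qquad \|f^{(q+1)}\|_{L^\infty((0,T);\mathcal V')}\le K$$ (that is, the $q$-th derivatives are Lipschitz continuous with constant $K$ on the closed intervals), we have $$\|\mathfrak p(t_n)-p^n\|_{\mathcal H_{\mathcal W}}^2\le C\tau^{2q}+C\sum_{j=0}^{q-1}\Big(\|\mathfrak p(t_j)-p^j\|_{\mathcal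 H_{\mathcal W}}^2+\tau\|\mathfrak p(t_j)-p^j\|_{\mathcal W}^2\Big),\qquad n=q,\dots,N.$$ -/

import Mathlib

open scoped NNReal

noncomputable section

/-- The generating polynomial `α(ζ) = ∑_{j=1}^q (1/j) ζ^{q-j} (ζ-1)^j` of the `q`-step BDF method. -/
def bdfAlpha (q : ℕ) : Polynomial ℝ :=
  ∑ j ∈ Finset.Icc 1 q,
    Polynomial.C (1 / (j : ℝ)) * Polynomial.X ^ (q - j) * (Polynomial.X - 1) ^ j

/-- The polynomial `β(ζ) = ζ^q` of the implicit `q`-step BDF method. -/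
def bdfBeta (q : ℕ) : Polynomial ℝ := Polynomial.X ^ q

/-- The polynomial `γ(ζ) = ζ^q - (ζ-1)^q` of the explicit `q`-step BDF method; its coefficients
`γ_0, …, γ_{q-1}` are the weights of the extrapolation. -/
def bdfGamma (q : ℕ) : Polynomial ℝ := Polynomial.X ^ q - (Polynomial.X - 1) ^ q

/-- `α̃ = α β`, of degree `2q`. -/
def bdfAlphaTilde (q : ℕ) : Polynomial ℝ := bdfAlpha q * bdfBeta q

/-- `α̂ = α γ`, of degree `2q - 1`. -/
def bdfAlphaHat (q : ℕ) : Polynomial ℝ := bdfAlpha q * bdfGamma q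

/-- `v ∈ W^{k+1,∞}` on the interval `s`, with `‖v^{(k+1)}‖_{L^∞} ≤ K`: `v` is `k` times continuously
differentiable on `s` and its `k`-th derivative is Lipschitz continuous with constant `K`. -/
def HasBoundedNextDeriv {E : Type*} [NormedAddCommGroup E] [NormedSpace ℝ E]
    (k : ℕ) (K : ℝ≥0) (s : Set ℝ) (v : ℝ → E) : Prop :=
  ContDiffOn ℝ (k : ℕ∞) v s ∧ LipschitzOnWith K (iteratedDerivWithin k v s) s

/-- The data of an abstract elliptic–parabolic system: real Hilbert spaces `V`, `W`, `H` with `W`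
continuously and densely embedded in `H` (the pivot space of the Gelfand triple `(W, H, W')`),
bounded symmetric coercive bilinear forms `a` on `V`, `b` on `W`, `c` on `H`, and a bounded
bilinear form `d` on `V × H` (the coupling). -/
structure EllipticParabolicSystem (V W H : Type*)
    [NormedAddCommGroup V] [InnerProductSpace ℝ V] [CompleteSpace V]
    [NormedAddCommGroup W] [InnerProductSpace ℝ W] [CompleteSpace W]
    [NormedAddCommGroup H] [InnerProductSpace ℝ H] [CompleteSpace H] where
  /-- the embedding of `W` in `H` -/
  emb : W →L[ℝ] H
  emb_injective : Function.Injective emb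
  emb_denseRange : DenseRange emb
  a : V →L[ℝ] V →L[ℝ] ℝ
  b : W →L[ℝ] W →L[ℝ] ℝ
  c : H →L[ℝ] H →L[ℝ] ℝ
  d : V →L[ℝ] H →L[ℝ] ℝ
  a_symm : ∀ u v, a u v = a v u
  b_symm : ∀ u v, b u v = b v u
  c_symm : ∀ u v, c u v = c v u
  /-- coercivity constants of `a`, `b`, `c` -/
  ca : ℝ
  cb : ℝ
  cc : ℝ
  /-- continuity constant of `d` -/
  Cd : ℝ
  ca_pos : 0 < ca
  cb_pos : 0 < cb
  cc_pos : 0 < cc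
  Cd_pos : 0 < Cd
  a_coercive : ∀ v, ca * ‖v‖ ^ 2 ≤ a v v
  b_coercive : ∀ w, cb * ‖w‖ ^ 2 ≤ b w w
  c_coercive : ∀ x, cc * ‖x‖ ^ 2 ≤ c x x
  d_le : ∀ v x, d v x ≤ Cd * ‖v‖ * ‖x‖

namespace EllipticParabolicSystem

variable {V W H : Type*}
  [NormedAddCommGroup V] [InnerProductSpace ℝ V] [CompleteSpace V]
  [NormedAddCommGroup W] [InnerProductSpace ℝ W] [CompleteSpace W]
  [NormedAddCommGroup H] [InnerProductSpace ℝ H] [CompleteSpace H]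

/-- The coupling strength `ω = C_d² / (c_a c_c)`. -/
def couplingStrength (S : EllipticParabolicSystem V W H) : ℝ := S.Cd ^ 2 / (S.ca * S.cc)

theorem isCoercive_a (S : EllipticParabolicSystem V W H) : IsCoercive S.a :=
  ⟨S.ca, S.ca_pos, fun u => by
    have h := S.a_coercive u
    rwa [pow_two, ← mul_assoc] at h⟩

/-- The inverse `A⁻¹ : V' → V` of the operator `A : V → V'` of the form `a` (Lax–Milgram). -/
def Ainv (S : EllipticParabolicSystem V W H) (l : V →L[ℝ] ℝ) : V :=
  S.isCoercive_a.continuousLinearEquivOfBilin.symm ((InnerProductSpace.toDual ℝ V).symm l)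

/-- `A (A⁻¹ l) = l`. -/
theorem a_Ainv (S : EllipticParabolicSystem V W H) (l : V →L[ℝ] ℝ) (v : V) :
    S.a (S.Ainv l) v = l v := by
  rw [← S.isCoercive_a.continuousLinearEquivOfBilin_apply, Ainv,
    ContinuousLinearEquiv.apply_symm_apply, InnerProductSpace.toDual_symm_apply]

/-- The functional `D A⁻¹ l` on `H`, for `l ∈ V'`; here `D : V → H` is the operator of `d`, and
`D u` is written as the functional `d(u, ·)` on `H`. -/
def DAinv (S : EllipticParabolicSystem V W H) (l : V →L[ℝ] ℝ) : H →L[ℝ] ℝ := S.d (S.Ainv l)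

/-- The operator `M = D A⁻¹ D⋆` on `H` (with values written as functionals on `H`), where
`D⋆ x = d(·, x) ∈ V'`. -/
def M (S : EllipticParabolicSystem V W H) (x : H) : H →L[ℝ] ℝ := S.DAinv (S.d.flip x)

/-- `𝔭 : [-qτ, T] → W` is a solution of the delay parabolic equation
`C 𝔭_t(t) + M ∑_{j<q} γ_j 𝔭_t(t - qτ + jτ) + B 𝔭(t) = g(t) - D A⁻¹ f_t(t)` in `W'`, `t ∈ (0, T]`.
The time derivative of `𝔭` is taken in `H`, the one of `f` in `V'`
(one-sided at the end points of the intervals). -/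
structure IsDelaySolution (S : EllipticParabolicSystem V W H) (q : ℕ) (τ T : ℝ)
    (f : ℝ → V →L[ℝ] ℝ) (g : ℝ → W →L[ℝ] ℝ) (𝔭 : ℝ → W) : Prop where
  differentiableOn : DifferentiableOn ℝ (fun s => S.emb (𝔭 s)) (Set.Icc (-(q * τ)) T)
  differentiableOn_force : DifferentiableOn ℝ f (Set.Icc 0 T)
  eq : ∀ t ∈ Set.Ioc 0 T, ∀ w : W,
    S.c (derivWithin (fun s => S.emb (𝔭 s)) (Set.Icc (-(q * τ)) T) t) (S.emb w)
      + S.M (∑ j ∈ Finset.range q, (bdfGamma q).coeff j •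
          derivWithin (fun s => S.emb (𝔭 s)) (Set.Icc (-(q * τ)) T) (t - q * τ + j * τ)) (S.emb w)
      + S.b (𝔭 t) w
    = g t w - S.DAinv (derivWithin f (Set.Icc 0 T) t) (S.emb w)

/-- `(p^n)`, `n = -q, …, N`, is produced by the implicit–explicit `q`-step BDF scheme with time step
`τ` and nodes `t_n = nτ`: the artificial values `p^{-1}, …, p^{-q}` are obtained from the starting
values `p^0, …, p^{q-1}` through `∑_{i<q} γ_i p^{n-q+i} = p^n`, `n = 0, …, q-1`, and
`C ∑_{i≤2q} α̃_i p^{n-2q+i} + M ∑_{i<2q} α̂_i p^{n-2q+i} + τ B p^n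
  = τ g(t_n) - D A⁻¹ ∑_{i≤2q} α̃_i f(t_{n-2q+i})` in `W'` for `n = q, …, N`.
(Values of `f` at negative times only occur with the coefficients `α̃_i = 0`, `i < q`.) -/
structure IsImexBDF (S : EllipticParabolicSystem V W H) (q N : ℕ) (τ : ℝ)
    (f : ℝ → V →L[ℝ] ℝ) (g : ℝ → W →L[ℝ] ℝ) (p : ℤ → W) : Prop where
  start : ∀ n : ℕ, n < q →
    ∑ i ∈ Finset.range q, (bdfGamma q).coeff i • p ((n : ℤ) - q + i) = p n
  step : ∀ n : ℕ, q ≤ n → n ≤ N → ∀ w : W,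
    S.c (∑ i ∈ Finset.range (2 * q + 1),
        (bdfAlphaTilde q).coeff i • S.emb (p ((n : ℤ) - 2 * q + i))) (S.emb w)
      + S.M (∑ i ∈ Finset.range (2 * q),
          (bdfAlphaHat q).coeff i • S.emb (p ((n : ℤ) - 2 * q + i))) (S.emb w)
      + τ * S.b (p n) w
    = τ * g (n * τ) w
      - S.DAinv (∑ i ∈ Finset.range (2 * q + 1),
          (bdfAlphaTilde q).coeff i • f (((n : ℝ) - 2 * q + i) * τ)) (S.emb w)

end EllipticParabolicSystem

end

/-! The error `e^n = 𝔭(t_n) - p^n` satisfies the scheme with a right-hand side that is a functional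
on `H` of size `O(τ^{q+1})`. The delay equation contains the same combination `γ` as the scheme, so
no extrapolation error appears: only the BDF approximation of the derivatives of `𝔭` and `f`
contributes (`error_equation`, `norm_consistencyError_le`). Summing over `N = T/τ` steps costs one
power of `τ`, provided the scheme is stable in `H` (`stability`).

Write `A = bdfDiff q`, `G = bdfExtrap q`, `μ = 2^q - 1`. In the backward shift the error equation
reads `C A e + M A G e + τ B e = ρ`. It is convolved with a multiplier polynomial `ν` and tested
with `e^n`; summation gives causal Toeplitz forms, and such a form is nonnegative when its symbol
has nonnegative real part on the unit circle (`toeplitz_nonneg`). Since `ω ≤ 1/μ` means `μM ≤ C`,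
the splitting `C + M G = (C - μM) + μM (1 + G/μ)` has nonnegative forms as coefficients. It is
therefore enough that one `ν` makes `Re ν ≥ 0` and `Re νA`, `Re νA(1 + G/μ)` at least `c sin² θ`
(`exists_multiplier`). The factor `1 + G/μ` vanishes at `z = -1` and `A` vanishes at `z = 1`, so no
uniform positive lower bound is possible; `sin² θ` still controls the last entry, because its
Toeplitz form telescopes (`toeplitz_coercive`).

Evaluating the resulting bound at the index where `‖e^n‖` is largest replaces a Gronwall argument.
Nonzero starting errors are moved to the right-hand side, where they affect only boundedly many
steps. -/

open Polynomial

/-! ### Shift operators and causal convolutions. -/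

section Shift

variable {E F : Type*} [AddCommGroup E] [Module ℝ E] [AddCommGroup F] [Module ℝ F]

/-- The backward shift of two-sided sequences. -/
def backShift (E : Type*) [AddCommGroup E] [Module ℝ E] : Module.End ℝ (ℤ → E) :=
  LinearMap.funLeft ℝ E (fun n => n - 1)

/-- The forward shift of two-sided sequences. -/
def fwdShift (E : Type*) [AddCommGroup E] [Module ℝ E] : Module.End ℝ (ℤ → E) :=
  LinearMap.funLeft ℝ E (fun n => n + 1)

theorem backShift_apply (y : ℤ → E) (n : ℤ) : backShift E y n = y (n - 1) := rfl

theorem fwdShift_apply (y : ℤ → E) (n : ℤ) : fwdShift E y n = y (n + 1) := rfl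

theorem fwdShift_mul_backShift : fwdShift E * backShift E = 1 := by
  ext y n
  simp [backShift_apply, fwdShift_apply]

theorem backShift_mul_fwdShift : backShift E * fwdShift E = 1 := by
  ext y n
  simp [backShift_apply, fwdShift_apply]

theorem commute_fwdShift_backShift : Commute (fwdShift E) (backShift E) := by
  rw [Commute, SemiconjBy, fwdShift_mul_backShift, backShift_mul_fwdShift]

theorem backShift_pow_apply (k : ℕ) (y : ℤ → E) (n : ℤ) :
    (backShift E ^ k) y n = y (n - k) := by
  induction k generalizing n with
  | zero => simp
  | succ k ih =>
    rw [pow_succ', Module.End.mul_apply, backShift_apply, ih]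
    congr 1
    push_cast
    ring

theorem fwdShift_pow_apply (k : ℕ) (y : ℤ → E) (n : ℤ) :
    (fwdShift E ^ k) y n = y (n + k) := by
  induction k generalizing n with
  | zero => simp
  | succ k ih =>
    rw [pow_succ', Module.End.mul_apply, fwdShift_apply, ih]
    congr 1
    push_cast
    ring

/-- The causal convolution of a two-sided sequence with the coefficients of a polynomial:
`(conv κ y) n = ∑ j, κ_j y (n - j)`. -/
noncomputable def conv (κ : ℝ[X]) (y : ℤ → E) : ℤ → E := aeval (backShift E) κ y

theorem conv_apply {κ : ℝ[X]} {D : ℕ} (h : κ.natDegree ≤ D) (y : ℤ → E) (n : ℤ) :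
    conv κ y n = ∑ j ∈ Finset.range (D + 1), κ.coeff j • y (n - j) := by
  rw [conv, aeval_eq_sum_range' (Nat.lt_succ_of_le h)]
  simp [LinearMap.sum_apply, Finset.sum_apply, backShift_pow_apply]

theorem aeval_fwdShift_apply {κ : ℝ[X]} {D : ℕ} (h : κ.natDegree < D) (y : ℤ → E) (n : ℤ) :
    aeval (fwdShift E) κ y n = ∑ j ∈ Finset.range D, κ.coeff j • y (n + j) := by
  rw [aeval_eq_sum_range' h]
  simp [LinearMap.sum_apply, Finset.sum_apply, fwdShift_pow_apply]

theorem conv_mul (κ l : ℝ[X]) (y : ℤ → E) : conv (κ * l) y = conv κ (conv l y) := by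
  simp [conv]

theorem conv_add_left (κ l : ℝ[X]) (y : ℤ → E) : conv (κ + l) y = conv κ y + conv l y := by
  simp [conv]

theorem conv_smul_left (r : ℝ) (κ : ℝ[X]) (y : ℤ → E) : conv (C r * κ) y = r • conv κ y := by
  rw [← smul_eq_C_mul]
  simp [conv]

theorem conv_one (y : ℤ → E) : conv 1 y = y := by simp [conv]

theorem conv_add (κ : ℝ[X]) (y z : ℤ → E) : conv κ (y + z) = conv κ y + conv κ z := by
  simp [conv]

theorem conv_sub (κ : ℝ[X]) (y z : ℤ → E) : conv κ (y - z) = conv κ y - conv κ z := by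
  simp [conv]

theorem conv_smul (κ : ℝ[X]) (r : ℝ) (y : ℤ → E) : conv κ (r • y) = r • conv κ y := by
  simp [conv]

theorem conv_map (κ : ℝ[X]) (f : E →ₗ[ℝ] F) (y : ℤ → E) (n : ℤ) :
    conv κ (fun k => f (y k)) n = f (conv κ y n) := by
  rw [conv_apply le_rfl, conv_apply le_rfl, map_sum]
  simp

theorem conv_congr {κ : ℝ[X]} {D : ℕ} (h : κ.natDegree ≤ D) {y z : ℤ → E} {n : ℤ}
    (hyz : ∀ k, n - D ≤ k → k ≤ n → y k = z k) : conv κ y n = conv κ z n := by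
  rw [conv_apply h, conv_apply h]
  refine Finset.sum_congr rfl fun j hj => ?_
  rw [hyz _ (by have := Finset.mem_range.1 hj; omega) (by omega)]

theorem conv_eq_zero {κ : ℝ[X]} {D : ℕ} (h : κ.natDegree ≤ D) {y : ℤ → E} {n : ℤ}
    (hy : ∀ k, n - D ≤ k → k ≤ n → y k = 0) : conv κ y n = 0 := by
  rw [conv_congr h (z := 0) hy]
  simp [conv]

end Shift

/-! ### Norm bounds for convolutions. -/

section ConvNorm

variable {E : Type*} [NormedAddCommGroup E] [NormedSpace ℝ E]

/-- The sum of the absolute values of the coefficients. -/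
noncomputable def coeffNorm (κ : ℝ[X]) : ℝ := ∑ j ∈ Finset.range (κ.natDegree + 1), |κ.coeff j|

theorem coeffNorm_nonneg (κ : ℝ[X]) : 0 ≤ coeffNorm κ :=
  Finset.sum_nonneg fun _ _ => abs_nonneg _

theorem norm_conv_le {κ : ℝ[X]} {D : ℕ} (h : κ.natDegree ≤ D) {y : ℤ → E} {n : ℤ} {B : ℝ}
    (hy : ∀ k, n - D ≤ k → k ≤ n → ‖y k‖ ≤ B) : ‖conv κ y n‖ ≤ coeffNorm κ * B := by
  rw [conv_apply le_rfl, coeffNorm, Finset.sum_mul]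
  refine (norm_sum_le _ _).trans (Finset.sum_le_sum fun j hj => ?_)
  rw [norm_smul, Real.norm_eq_abs]
  have := Finset.mem_range.1 hj
  exact mul_le_mul_of_nonneg_left (hy _ (by omega) (by omega)) (abs_nonneg _)

/-- Young's inequality in `ℓ¹`: each backward translate of a sequence vanishing at negative indices
has a partial sum no larger than that of the sequence. -/
theorem sum_norm_conv_le (κ : ℝ[X]) {y : ℤ → E} (hy : ∀ k < 0, y k = 0) (m : ℕ) :
    ∑ n ∈ Finset.range (m + 1), ‖conv κ y n‖
      ≤ coeffNorm κ * ∑ n ∈ Finset.range (m + 1), ‖y n‖ := by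
  have key : ∀ j : ℕ, ∑ n ∈ Finset.range (m + 1), ‖y ((n : ℤ) - j)‖
      ≤ ∑ n ∈ Finset.range (m + 1), ‖y n‖ := by
    intro j
    have h1 : ∑ n ∈ Finset.range (m + 1), ‖y ((n : ℤ) - j)‖
        = ∑ n ∈ (Finset.range (m + 1)).filter (fun n => j ≤ n), ‖y ((n - j : ℕ) : ℤ)‖ := by
      rw [Finset.sum_filter]
      refine Finset.sum_congr rfl fun n _ => ?_
      split_ifs with h
      · rw [Nat.cast_sub h]
      · rw [hy _ (by omega), norm_zero]
    rw [h1, ← Finset.sum_image (f := fun n : ℕ => ‖y n‖) (g := fun n => n - j)]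
    · refine Finset.sum_le_sum_of_subset_of_nonneg ?_ fun _ _ _ => norm_nonneg _
      intro k hk
      simp only [Finset.mem_image, Finset.mem_filter, Finset.mem_range] at hk ⊢
      omega
    · intro a ha b hb hab
      simp only [Finset.coe_filter, Set.mem_ofPred_eq] at ha hb hab
      omega
  calc ∑ n ∈ Finset.range (m + 1), ‖conv κ y n‖
      ≤ ∑ n ∈ Finset.range (m + 1), ∑ j ∈ Finset.range (κ.natDegree + 1),
          |κ.coeff j| * ‖y ((n : ℤ) - j)‖ := by
        refine Finset.sum_le_sum fun n _ => ?_
        rw [conv_apply le_rfl]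
        refine (norm_sum_le _ _).trans (le_of_eq ?_)
        simp [norm_smul]
    _ = ∑ j ∈ Finset.range (κ.natDegree + 1), |κ.coeff j| *
          ∑ n ∈ Finset.range (m + 1), ‖y ((n : ℤ) - j)‖ := by
        rw [Finset.sum_comm]
        simp [Finset.mul_sum]
    _ ≤ _ := by
        rw [coeffNorm, Finset.sum_mul]
        exact Finset.sum_le_sum fun j _ => mul_le_mul_of_nonneg_left (key j) (abs_nonneg _)

end ConvNorm

/-! ### Positivity of Toeplitz forms from their symbols. -/

section Toeplitz

/-- The real part of `κ(e^{iθ})`. -/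
noncomputable def symbolRe (κ : ℝ[X]) (θ : ℝ) : ℝ := (aeval (Complex.exp (θ * Complex.I)) κ).re

theorem re_exp_pow (θ : ℝ) (j : ℕ) :
    (Complex.exp (θ * Complex.I) ^ j).re = Real.cos (j * θ) := by
  rw [← Complex.exp_nat_mul, ← mul_assoc]
  have := Complex.exp_ofReal_mul_I_re (j * θ)
  push_cast at this
  exact this

theorem symbolRe_eq (κ : ℝ[X]) (θ : ℝ) :
    symbolRe κ θ = ∑ j ∈ Finset.range (κ.natDegree + 1), κ.coeff j * Real.cos (j * θ) := by
  rw [symbolRe, aeval_eq_sum_range, Complex.re_sum]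
  refine Finset.sum_congr rfl fun j _ => ?_
  rw [Complex.smul_re, re_exp_pow, smul_eq_mul]

theorem symbolRe_add (κ l : ℝ[X]) (θ : ℝ) : symbolRe (κ + l) θ = symbolRe κ θ + symbolRe l θ := by
  simp [symbolRe]

theorem symbolRe_C_mul (r : ℝ) (κ : ℝ[X]) (θ : ℝ) :
    symbolRe (C r * κ) θ = r * symbolRe κ θ := by
  simp [symbolRe]

theorem integral_cos_int_mul (k : ℤ) :
    ∫ θ in (0 : ℝ)..2 * Real.pi, Real.cos (k * θ) = if k = 0 then 2 * Real.pi else 0 := by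
  split_ifs with h
  · simp [h]
  · have hk : (k : ℝ) ≠ 0 := by exact_mod_cast h
    rw [intervalIntegral.integral_comp_mul_left (fun x => Real.cos x) hk, integral_cos]
    have : Real.sin (k * (2 * Real.pi)) = 0 := by
      have := Real.sin_int_mul_pi (2 * k)
      push_cast at this
      rw [← this]
      congr 1
      ring
    simp [this]

theorem integral_cos_mul_cos (j k : ℤ) :
    ∫ θ in (0 : ℝ)..2 * Real.pi, Real.cos (j * θ) * Real.cos (k * θ)
      = Real.pi * ((if j = k then 1 else 0) + (if j = -k then 1 else 0)) := by
  have h : ∀ θ : ℝ, Real.cos (j * θ) * Real.cos (k * θ)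
      = 2⁻¹ * (Real.cos ((j - k : ℤ) * θ) + Real.cos ((j + k : ℤ) * θ)) := by
    intro θ
    push_cast
    rw [sub_mul, add_mul, Real.cos_sub, Real.cos_add]
    ring
  simp_rw [h]
  rw [intervalIntegral.integral_const_mul, intervalIntegral.integral_add
    (by apply Continuous.intervalIntegrable; fun_prop)
    (by apply Continuous.intervalIntegrable; fun_prop),
    integral_cos_int_mul, integral_cos_int_mul]
  simp only [sub_eq_zero, add_eq_zero_iff_eq_neg]
  split_ifs <;> ring

variable {E : Type*} [AddCommGroup E] [Module ℝ E]

/-- The left side is `P` evaluated on the real and imaginary parts of the Fourier transform of the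
truncated sequence; this makes the double cosine sum nonnegative when `P` is. -/
theorem bilin_cos_sin (P : LinearMap.BilinForm ℝ E) (y : ℕ → E) (m : ℕ) (θ : ℝ) :
    P (∑ n ∈ Finset.range m, Real.cos (n * θ) • y n) (∑ n ∈ Finset.range m, Real.cos (n * θ) • y n)
      + P (∑ n ∈ Finset.range m, Real.sin (n * θ) • y n)
          (∑ n ∈ Finset.range m, Real.sin (n * θ) • y n)
      = ∑ n ∈ Finset.range m, ∑ k ∈ Finset.range m,
          Real.cos ((n - k : ℤ) * θ) * P (y k) (y n) := by
  simp only [map_sum, LinearMap.sum_apply, map_smul, LinearMap.smul_apply, smul_eq_mul]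
  rw [← Finset.sum_add_distrib]
  refine Finset.sum_congr rfl fun n _ => ?_
  rw [Finset.mul_sum, Finset.mul_sum, ← Finset.sum_add_distrib]
  refine Finset.sum_congr rfl fun k _ => ?_
  push_cast
  rw [sub_mul, Real.cos_sub]
  ring

/-- A causal Toeplitz form with a symbol of nonnegative real part is nonnegative. -/
theorem toeplitz_nonneg {κ : ℝ[X]} (hκ : ∀ θ, 0 ≤ symbolRe κ θ)
    {P : LinearMap.BilinForm ℝ E} (hsymm : ∀ x y, P x y = P y x) (hP : ∀ x, 0 ≤ P x x)
    {y : ℤ → E} (hy : ∀ k < 0, y k = 0) (m : ℕ) :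
    0 ≤ ∑ n ∈ Finset.range m, P (conv κ y n) (y n) := by
  set F : ℝ → ℝ := fun θ => ∑ n ∈ Finset.range m, ∑ k ∈ Finset.range m,
          Real.cos ((n - k : ℤ) * θ) * P (y k) (y n) with hF
  have hFnn : ∀ θ, 0 ≤ F θ := by
    intro θ
    rw [hF]
    simp only
    rw [← bilin_cos_sin P (fun n => y n)]
    exact add_nonneg (hP _) (hP _)
  have hint : 0 ≤ ∫ θ in (0 : ℝ)..2 * Real.pi, symbolRe κ θ * F θ :=
    intervalIntegral.integral_nonneg (by positivity) fun θ _ => mul_nonneg (hκ θ) (hFnn θ)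
  -- Parseval: by orthogonality of the cosines only the pairs with `n - k = ±j` survive, and
  -- symmetry of `P` makes the two diagonals contribute equally.
  have hterm : ∀ j : ℕ, ∫ θ in (0 : ℝ)..2 * Real.pi, Real.cos (j * θ) * F θ
      = 2 * Real.pi * ∑ n ∈ Finset.range m, P (y ((n : ℤ) - j)) (y n) := by
    intro j
    have e1 : ∀ θ, Real.cos (j * θ) * F θ = ∑ n ∈ Finset.range m, ∑ k ∈ Finset.range m,
        P (y k) (y n) * (Real.cos ((j : ℤ) * θ) * Real.cos ((n - k : ℤ) * θ)) := by
      intro θ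
      rw [hF]
      simp only [Finset.mul_sum]
      refine Finset.sum_congr rfl fun n _ => Finset.sum_congr rfl fun k _ => ?_
      push_cast
      ring
    simp_rw [e1]
    rw [intervalIntegral.integral_finsetSum
      (fun n _ => by apply Continuous.intervalIntegrable; fun_prop)]
    have e2 : ∀ n ∈ Finset.range m, (∫ θ in (0 : ℝ)..2 * Real.pi, ∑ k ∈ Finset.range m,
        P (y k) (y n) * (Real.cos ((j : ℤ) * θ) * Real.cos ((n - k : ℤ) * θ)))
        = ∑ k ∈ Finset.range m, (Real.pi * (if (j : ℤ) = n - k then P (y k) (y n) else 0)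
          + Real.pi * (if (j : ℤ) = k - n then P (y n) (y k) else 0)) := by
      intro n _
      rw [intervalIntegral.integral_finsetSum
        (fun n _ => by apply Continuous.intervalIntegrable; fun_prop)]
      refine Finset.sum_congr rfl fun k _ => ?_
      rw [intervalIntegral.integral_const_mul, integral_cos_mul_cos, neg_sub, hsymm (y n)]
      split_ifs <;> ring
    rw [Finset.sum_congr rfl e2]
    simp_rw [Finset.sum_add_distrib]
    rw [Finset.sum_comm (f := fun (n k : ℕ) =>
      Real.pi * (if (j : ℤ) = k - n then P (y n) (y k) else 0)), ← two_mul, mul_assoc]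
    congr 1
    rw [Finset.mul_sum]
    refine Finset.sum_congr rfl fun n hn => ?_
    rw [← Finset.mul_sum]
    congr 1
    -- Truncating to indices below `m` loses nothing: `n - j` is either an index below `m` or
    -- negative, where `y` vanishes.
    by_cases h : j ≤ n
    · rw [Finset.sum_eq_single (n - j)]
      · rw [if_pos (by omega), Nat.cast_sub h]
      · intro k _ hk
        rw [if_neg (by omega)]
      · intro hk
        simp only [Finset.mem_range] at hk hn
        omega
    · rw [hy ((n : ℤ) - j) (by omega), map_zero, LinearMap.zero_apply]
      refine Finset.sum_eq_zero fun k _ => ?_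
      rw [if_neg (by omega)]
  have hsum : ∫ θ in (0 : ℝ)..2 * Real.pi, symbolRe κ θ * F θ
      = 2 * Real.pi * ∑ n ∈ Finset.range m, P (conv κ y n) (y n) := by
    have e3 : ∀ θ, symbolRe κ θ * F θ = ∑ j ∈ Finset.range (κ.natDegree + 1),
        κ.coeff j * (Real.cos (j * θ) * F θ) := by
      intro θ
      rw [symbolRe_eq, Finset.sum_mul]
      simp_rw [mul_assoc]
    simp_rw [e3]
    rw [intervalIntegral.integral_finsetSum
      (fun n _ => by apply Continuous.intervalIntegrable; rw [hF]; fun_prop)]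
    simp_rw [intervalIntegral.integral_const_mul, hterm, conv_apply le_rfl, map_sum,
      LinearMap.sum_apply, map_smul, LinearMap.smul_apply, smul_eq_mul]
    rw [Finset.sum_comm (s := Finset.range m), Finset.mul_sum]
    refine Finset.sum_congr rfl fun j _ => ?_
    rw [← Finset.mul_sum]
    ring
  rw [hsum] at hint
  exact nonneg_of_mul_nonneg_right hint (by positivity)

theorem symbolRe_one_sub_X_sq (θ : ℝ) :
    symbolRe (C (1 / 2) * (1 - X ^ 2)) θ = Real.sin θ ^ 2 := by
  rw [symbolRe_C_mul, symbolRe]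
  have := re_exp_pow θ 2
  simp only [map_sub, map_one, map_pow, aeval_X, Complex.sub_re, Complex.one_re, this]
  push_cast
  rw [Real.cos_two_mul, Real.sin_sq]
  ring

/-- `2 P(u - v, u) ≥ P(u, u) - P(v, v)` telescopes with stride two, so the last two diagonal terms
remain. -/
theorem sum_bilin_diff_ge {P : LinearMap.BilinForm ℝ E} (hsymm : ∀ x y, P x y = P y x)
    (hP : ∀ x, 0 ≤ P x x) {y : ℤ → E} (hy : ∀ k < 0, y k = 0) (m : ℕ) :
    P (y m) (y m) + P (y (m - 1)) (y (m - 1))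
      ≤ 2 * ∑ n ∈ Finset.range (m + 1), P (y n - y (n - 2)) (y n) := by
  have key : ∀ u v : E, P u u - P v v ≤ 2 * P (u - v) u := by
    intro u v
    have := hP (u - v)
    simp only [map_sub, LinearMap.sub_apply] at this ⊢
    rw [hsymm u v] at this
    linarith
  induction m with
  | zero =>
    have := hP (y 0)
    simp [hy (-1) (by norm_num), hy (-2) (by norm_num)]
    linarith
  | succ m ih =>
    rw [Finset.sum_range_succ]
    have h := key (y ((m + 1 : ℕ) : ℤ)) (y (((m + 1 : ℕ) : ℤ) - 2))
    have e1 : ((m + 1 : ℕ) : ℤ) - 2 = m - 1 := by push_cast; ring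
    have e2 : ((m + 1 : ℕ) : ℤ) - 1 = m := by push_cast; ring
    rw [e1] at h ⊢
    rw [e2]
    linarith

/-- Coercivity of a causal Toeplitz form: if the real part of the symbol dominates `c sin² θ`, then
the form controls the last entry. -/
theorem toeplitz_coercive {κ : ℝ[X]} {c : ℝ} (hc : 0 ≤ c)
    (hκ : ∀ θ, c * Real.sin θ ^ 2 ≤ symbolRe κ θ)
    {P : LinearMap.BilinForm ℝ E} (hsymm : ∀ x y, P x y = P y x) (hP : ∀ x, 0 ≤ P x x)
    {y : ℤ → E} (hy : ∀ k < 0, y k = 0) (m : ℕ) :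
    c / 4 * P (y m) (y m) ≤ ∑ n ∈ Finset.range (m + 1), P (conv κ y n) (y n) := by
  -- Subtracting `(c/2)(1 - X^2)`, whose symbol has real part `c sin² θ`, leaves a nonnegative
  -- symbol; the subtracted form is bounded below by `sum_bilin_diff_ge`.
  have h1 := toeplitz_nonneg (κ := κ + C (-c) * (C (1 / 2) * (1 - X ^ 2)))
    (fun θ => by
      rw [symbolRe_add, symbolRe_C_mul, symbolRe_one_sub_X_sq]
      linarith [hκ θ]) hsymm hP hy (m + 1)
  have h2 := sum_bilin_diff_ge hsymm hP hy m
  have h3 := hP (y (m - 1))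
  have e : ∀ n : ℤ, conv (κ + C (-c) * (C (1 / 2) * (1 - X ^ 2))) y n
      = conv κ y n - (c / 2) • (y n - y (n - 2)) := by
    intro n
    rw [conv_add_left, conv_smul_left, conv_smul_left]
    have : conv (1 - X ^ 2) y n = y n - y (n - 2) := by
      simp [conv, backShift_pow_apply]
    simp only [Pi.add_apply, Pi.smul_apply, this, smul_smul]
    module
  simp only [e, map_sub, map_smul, LinearMap.sub_apply, LinearMap.smul_apply, smul_eq_mul,
    Finset.sum_sub_distrib, ← Finset.mul_sum] at h1
  simp only [map_sub, LinearMap.sub_apply, Finset.sum_sub_distrib] at h2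
  nlinarith

end Toeplitz

/-! ### BDF symbols, multipliers and positivity certificates. -/

/-- The polynomial `∑_{j=1}^q (1/j) (1 - z)^j`, the reverse of `bdfAlpha q`. -/
noncomputable def bdfDiff (q : ℕ) : ℝ[X] := ∑ j ∈ Finset.Icc 1 q, C (1 / (j : ℝ)) * (1 - X) ^ j

/-- The polynomial `1 - (1 - z)^q`, the reverse of `bdfGamma q`. -/
noncomputable def bdfExtrap (q : ℕ) : ℝ[X] := 1 - (1 - X) ^ q

/-- With `y = cos θ` this is `Re ν` for `ν = 2 + z`. All certificates below use the same device: on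
each subinterval, with `s` and `r` the distances to its end points, the polynomial is written in
Bernstein form with nonnegative coefficients. The subdivision points are chosen so that this
succeeds. -/
theorem multiplier_certificate_four {y : ℝ} (h₁ : -1 ≤ y) (h₂ : y ≤ 1) :
    0 ≤ (2) + (1) * y := by
  obtain ⟨s, hs⟩ : ∃ s, s = y - (-1) := ⟨_, rfl⟩
  obtain ⟨r, hr⟩ : ∃ r, r = 1 - y := ⟨_, rfl⟩
  have hs₀ : 0 ≤ s := by linarith
  have hr₀ : 0 ≤ r := by linarith
  have h : 0 ≤ (1 / 2) * r + (3 / 2) * s := by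
    positivity
  refine h.trans_eq ?_
  rw [hs, hr]
  ring

/-- The cofactor of `1 - y` in `Re νA - (1/1000) sin² θ`; the factor `1 - y` comes from the zero of
`A` at `z = 1`. -/
theorem implicit_certificate_four {y : ℝ} (h₁ : -1 ≤ y) (h₂ : y ≤ 1) :
    0 ≤ (3997 / 3000) + (-13003 / 3000) * y + (19 / 3) * y ^ 2 + (8 / 3) * y ^ 3 + (-4) * y ^ 4 := by
  rcases le_total y (9 / 16) with h₃ | h₃
  · obtain ⟨s, hs⟩ : ∃ s, s = y - (-1) := ⟨_, rfl⟩
    obtain ⟨r, hr⟩ : ∃ r, r = 9 / 16 - y := ⟨_, rfl⟩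
    have hs₀ : 0 ≤ s := by linarith
    have hr₀ : 0 ≤ r := by linarith
    have h : 0 ≤ (1048576 / 1171875) * r ^ 4 + (31721984 / 5859375) * s * r ^ 3 + (2108672 / 5859375) * s ^
      2 * r ^ 2 + (22912 / 5859375) * s ^ 3 * r + (955844 / 5859375) * s ^ 4 := by
      positivity
    refine h.trans_eq ?_
    rw [hs, hr]
    ring
  · obtain ⟨s, hs⟩ : ∃ s, s = y - (9 / 16) := ⟨_, rfl⟩
    obtain ⟨r, hr⟩ : ∃ r, r = 1 - y := ⟨_, rfl⟩
    have hs₀ : 0 ≤ s := by linarith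
    have hr₀ : 0 ≤ r := by linarith
    have h : 0 ≤ (955844 / 36015) * r ^ 4 + (40729216 / 300125) * s * r ^ 3 + (238425344 / 900375) * s ^ 2
      * r ^ 2 + (192838144 / 900375) * s ^ 3 * r + (16367616 / 300125) * s ^ 4 := by
      positivity
    refine h.trans_eq ?_
    rw [hs, hr]
    ring

/-- The cofactor of `(1 - y)(1 + y)` in `Re νA(1 + G/15) - (1/1000) sin² θ`. The factor `1 + y`
reflects `G(-1) = 1 - 2^4 = -15`, the critical point for the coupling bound. -/
theorem critical_certificate_four {y : ℝ} (h₁ : -1 ≤ y) (h₂ : y ≤ 1) :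
    0 ≤ (15991 / 9000) + (-172 / 15) * y + (1304 / 45) * y ^ 2 + (-1252 / 45) * y ^ 3 + (64 / 15)
      * y ^ 4 + (752 / 45) * y ^ 5 + (-704 / 45) * y ^ 6 + (64 / 15) * y ^ 7 := by
  rcases le_total y (1 / 2) with h₃ | h₃
  · obtain ⟨s, hs⟩ : ∃ s, s = y - (-1) := ⟨_, rfl⟩
    obtain ⟨r, hr⟩ : ∃ r, r = 1 / 2 - y := ⟨_, rfl⟩
    have hs₀ : 0 ≤ s := by linarith
    have hr₀ : 0 ≤ r := by linarith
    have h : 0 ≤ (5427056 / 2460375) * r ^ 7 + (46053392 / 2460375) * s * r ^ 6 + (15957392 / 820125) * s ^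
      2 * r ^ 5 + (4509392 / 492075) * s ^ 3 * r ^ 4 + (969872 / 492075) * s ^ 4 * r ^ 3 +
      (16592 / 820125) * s ^ 5 * r ^ 2 + (59792 / 2460375) * s ^ 6 * r + (55856 / 2460375) * s ^
      7 := by
      positivity
    refine h.trans_eq ?_
    rw [hs, hr]
    ring
  · obtain ⟨s, hs⟩ : ∃ s, s = y - (1 / 2) := ⟨_, rfl⟩
    obtain ⟨r, hr⟩ : ∃ r, r = 1 - y := ⟨_, rfl⟩
    have hs₀ : 0 ≤ s := by linarith
    have hr₀ : 0 ≤ r := by linarith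
    have h : 0 ≤ (55856 / 1125) * r ^ 7 + (501392 / 1125) * s * r ^ 6 + (643792 / 375) * s ^ 2 * r ^ 5 +
      (263984 / 75) * s ^ 3 * r ^ 4 + (930512 / 225) * s ^ 4 * r ^ 3 + (3129776 / 1125) * s ^ 5
      * r ^ 2 + (1099792 / 1125) * s ^ 6 * r + (51152 / 375) * s ^ 7 := by
      positivity
    refine h.trans_eq ?_
    rw [hs, hr]
    ring

theorem multiplier_certificate_five {y : ℝ} (h₁ : -1 ≤ y) (h₂ : y ≤ 1) :
    0 ≤ (1) + (2) * y + (2) * y ^ 2 := by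
  rcases le_total y (0) with h₃ | h₃
  · obtain ⟨s, hs⟩ : ∃ s, s = y - (-1) := ⟨_, rfl⟩
    obtain ⟨r, hr⟩ : ∃ r, r = 0 - y := ⟨_, rfl⟩
    have hs₀ : 0 ≤ s := by linarith
    have hr₀ : 0 ≤ r := by linarith
    have h : 0 ≤ (1) * r ^ 2 + (1) * s ^ 2 := by
      positivity
    refine h.trans_eq ?_
    rw [hs, hr]
    ring
  · obtain ⟨s, hs⟩ : ∃ s, s = y - (0) := ⟨_, rfl⟩
    obtain ⟨r, hr⟩ : ∃ r, r = 1 - y := ⟨_, rfl⟩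
    have hs₀ : 0 ≤ s := by linarith
    have hr₀ : 0 ≤ r := by linarith
    have h : 0 ≤ (1) * r ^ 2 + (4) * s * r + (5) * s ^ 2 := by
      positivity
    refine h.trans_eq ?_
    rw [hs, hr]
    ring

theorem implicit_certificate_five {y : ℝ} (h₁ : -1 ≤ y) (h₂ : y ≤ 1) :
    0 ≤ (6797 / 3000) + (-8803 / 3000) * y + (154 / 15) * y ^ 2 + (256 / 15) * y ^ 3 + (-256 / 15)
      * y ^ 4 + (-72 / 5) * y ^ 5 + (64 / 5) * y ^ 6 := by
  rcases le_total y (-1 / 16) with h₃ | h₃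
  · obtain ⟨s, hs⟩ : ∃ s, s = y - (-1) := ⟨_, rfl⟩
    obtain ⟨r, hr⟩ : ∃ r, r = -1 / 16 - y := ⟨_, rfl⟩
    have hs₀ : 0 ≤ s := by linarith
    have hr₀ : 0 ≤ r := by linarith
    have h : 0 ≤ (2147483648 / 170859375) * r ^ 6 + (712638464 / 284765625) * s * r ^ 5 + (4180148224 /
      56953125) * s ^ 2 * r ^ 4 + (23586340864 / 170859375) * s ^ 3 * r ^ 3 + (5194590208 /
      56953125) * s ^ 4 * r ^ 2 + (313072256 / 11390625) * s ^ 5 * r + (3126544192 / 854296875)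
      * s ^ 6 := by
      positivity
    refine h.trans_eq ?_
    rw [hs, hr]
    ring
  · obtain ⟨s, hs⟩ : ∃ s, s = y - (-1 / 16) := ⟨_, rfl⟩
    obtain ⟨r, hr⟩ : ∃ r, r = 1 - y := ⟨_, rfl⟩
    have hs₀ : 0 ≤ s := by linarith
    have hr₀ : 0 ≤ r := by linarith
    have h : 0 ≤ (3126544192 / 1810317675) * r ^ 6 + (22347706496 / 3017196125) * s * r ^ 5 + (29669009408
      / 1810317675) * s ^ 2 * r ^ 4 + (26125074432 / 603439225) * s ^ 3 * r ^ 3 + (125350445056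
      / 1810317675) * s ^ 4 * r ^ 2 + (10650779648 / 362063535) * s ^ 5 * r + (16773021696 /
      3017196125) * s ^ 6 := by
      positivity
    refine h.trans_eq ?_
    rw [hs, hr]
    ring

theorem critical_certificate_five {y : ℝ} (h₁ : -1 ≤ y) (h₂ : y ≤ 1) :
    0 ≤ (62369 / 31000) + (-1036 / 155) * y + (12808 / 465) * y ^ 2 + (-11428 / 465) * y ^ 3 +
      (-5512 / 465) * y ^ 4 + (27424 / 465) * y ^ 5 + (-4928 / 93) * y ^ 6 + (-5824 / 155) * y ^
      7 + (45184 / 465) * y ^ 8 + (-9472 / 155) * y ^ 9 + (2048 / 155) * y ^ 10 := by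
  rcases le_total y (3 / 16) with h₃ | h₃
  · obtain ⟨s, hs⟩ : ∃ s, s = y - (-1) := ⟨_, rfl⟩
    obtain ⟨r, hr⟩ : ∃ r, r = 3 / 16 - y := ⟨_, rfl⟩
    have hs₀ : 0 ≤ s := by linarith
    have hr₀ : 0 ≤ r := by linarith
    have h : 0 ≤ (622319320713658368 / 23757881748978875) * r ^ 10 + (97885946808107008 /
      14254729049387325) * s * r ^ 9 + (1922087698495963136 / 14254729049387325) * s ^ 2 * r ^ 8
      + (2044577265601216512 / 4751576349795775) * s ^ 3 * r ^ 7 + (2612280804671225856 /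
      4751576349795775) * s ^ 4 * r ^ 6 + (28471489145400721408 / 71273645246936625) * s ^ 5 * r
      ^ 5 + (2671333018349600768 / 14254729049387325) * s ^ 6 * r ^ 4 + (286273855030034432 /
      4751576349795775) * s ^ 7 * r ^ 3 + (6523970390491136 / 459829969335075) * s ^ 8 * r ^ 2 +
      (12268744213549056 / 4751576349795775) * s ^ 9 * r + (6653200782727168 /
      23757881748978875) * s ^ 10 := by
      positivity
    refine h.trans_eq ?_
    rw [hs, hr]
    ring
  · obtain ⟨s, hs⟩ : ∃ s, s = y - (3 / 16) := ⟨_, rfl⟩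
    obtain ⟨r, hr⟩ : ∃ r, r = 1 - y := ⟨_, rfl⟩
    have hs₀ : 0 ≤ s := by linarith
    have hr₀ : 0 ≤ r := by linarith
    have h : 0 ≤ (6653200782727168 / 534201655914875) * r ^ 10 + (14016377648336896 / 106840331182975) * s
      * r ^ 9 + (222504823019503616 / 320520993548925) * s ^ 2 * r ^ 8 + (717474739574276096 /
      320520993548925) * s ^ 3 * r ^ 7 + (1501126974502862848 / 320520993548925) * s ^ 4 * r ^ 6
      + (3511169638450855936 / 534201655914875) * s ^ 5 * r ^ 5 + (661837527002382336 /
      106840331182975) * s ^ 6 * r ^ 4 + (1217803197209378816 / 320520993548925) * s ^ 7 * r ^ 3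
      + (156224332970852352 / 106840331182975) * s ^ 8 * r ^ 2 + (104098187505041408 /
      320520993548925) * s ^ 9 * r + (17587925436858368 / 534201655914875) * s ^ 10 := by
      positivity
    refine h.trans_eq ?_
    rw [hs, hr]
    ring

theorem multiplier_certificate_six {y : ℝ} (h₁ : -1 ≤ y) (h₂ : y ≤ 1) :
    0 ≤ (1) + (6) * y + (14) * y ^ 2 + (-8) * y ^ 4 := by
  rcases le_total y (-3 / 16) with h₃ | h₃
  · obtain ⟨s, hs⟩ : ∃ s, s = y - (-1) := ⟨_, rfl⟩
    obtain ⟨r, hr⟩ : ∃ r, r = -3 / 16 - y := ⟨_, rfl⟩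
    have hs₀ : 0 ≤ s := by linarith
    have hr₀ : 0 ≤ r := by linarith
    have h : 0 ≤ (65536 / 28561) * r ^ 4 + (794624 / 28561) * s * r ^ 3 + (519680 / 28561) * s ^ 2 * r ^ 2
      + (42496 / 28561) * s ^ 3 * r + (23416 / 28561) * s ^ 4 := by
      positivity
    refine h.trans_eq ?_
    rw [hs, hr]
    ring
  · obtain ⟨s, hs⟩ : ∃ s, s = y - (-3 / 16) := ⟨_, rfl⟩
    obtain ⟨r, hr⟩ : ∃ r, r = 1 - y := ⟨_, rfl⟩
    have hs₀ : 0 ≤ s := by linarith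
    have hr₀ : 0 ≤ r := by linarith
    have h : 0 ≤ (23416 / 130321) * r ^ 4 + (168448 / 130321) * s * r ^ 3 + (1502720 / 130321) * s ^ 2 * r
      ^ 2 + (3252224 / 130321) * s ^ 3 * r + (851968 / 130321) * s ^ 4 := by
      positivity
    refine h.trans_eq ?_
    rw [hs, hr]
    ring

theorem implicit_certificate_six {y : ℝ} (h₁ : -1 ≤ y) (h₂ : y ≤ 1) :
    0 ≤ (5197 / 3000) + (797 / 3000) * y + (1142 / 15) * y ^ 2 + (1268 / 15) * y ^ 3 + (-1264 / 5)
      * y ^ 4 + (-2248 / 15) * y ^ 5 + (6176 / 15) * y ^ 6 + (-96 / 5) * y ^ 7 + (-3328 / 15) *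
      y ^ 8 + (256 / 3) * y ^ 9 := by
  rcases le_total y (-3 / 16) with h₃ | h₃
  · obtain ⟨s, hs⟩ : ∃ s, s = y - (-1) := ⟨_, rfl⟩
    obtain ⟨r, hr⟩ : ∃ r, r = -3 / 16 - y := ⟨_, rfl⟩
    have hs₀ : 0 ≤ s := by linarith
    have hr₀ : 0 ≤ r := by linarith
    have h : 0 ≤ (1099511627776 / 12235960815) * r ^ 9 + (244383102271488 / 101966340125) * s * r ^ 8 +
      (1079755315085312 / 305899020375) * s ^ 2 * r ^ 7 + (272472255496192 / 305899020375) * s ^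
      3 * r ^ 6 + (192302320451584 / 305899020375) * s ^ 4 * r ^ 5 + (14686407360512 /
      4706138775) * s ^ 5 * r ^ 4 + (981454693597184 / 305899020375) * s ^ 6 * r ^ 3 +
      (141963518910464 / 101966340125) * s ^ 7 * r ^ 2 + (86046017626112 / 305899020375) * s ^ 8
      * r + (7020923051264 / 305899020375) * s ^ 9 := by
      positivity
    refine h.trans_eq ?_
    rw [hs, hr]
    ring
  · clear h₁
    rcases le_total y (13 / 16) with h₃ | h₃
    · obtain ⟨s, hs⟩ : ∃ s, s = y - (-3 / 16) := ⟨_, rfl⟩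
      obtain ⟨r, hr⟩ : ∃ r, r = 13 / 16 - y := ⟨_, rfl⟩
      have hs₀ : 0 ≤ s := by linarith
      have hr₀ : 0 ≤ r := by linarith
      have h : 0 ≤ (356531248697 / 100663296000) * r ^ 9 + (1780174352977 / 100663296000) * s * r ^ 8 +
        (164560651681 / 25165824000) * s ^ 2 * r ^ 7 + (88818199033 / 5033164800) * s ^ 3 * r ^
        6 + (30208383220423 / 50331648000) * s ^ 4 * r ^ 5 + (82614713788151 / 50331648000) * s
        ^ 5 * r ^ 4 + (39055479508493 / 25165824000) * s ^ 6 * r ^ 3 + (18516094186801 /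
        25165824000) * s ^ 7 * r ^ 2 + (3710126430541 / 20132659200) * s ^ 8 * r + (647894139267
        / 33554432000) * s ^ 9 := by
        positivity
      refine h.trans_eq ?_
      rw [hs, hr]
      ring
    · obtain ⟨s, hs⟩ : ∃ s, s = y - (13 / 16) := ⟨_, rfl⟩
      obtain ⟨r, hr⟩ : ∃ r, r = 1 - y := ⟨_, rfl⟩
      have hs₀ : 0 ≤ s := by linarith
      have hr₀ : 0 ≤ r := by linarith
      have h : 0 ≤ (55286966550784 / 820125) * r ^ 9 + (1475828250591232 / 2460375) * s * r ^ 8 +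
        (5822529276944384 / 2460375) * s ^ 2 * r ^ 7 + (2674049937047552 / 492075) * s ^ 3 * r ^
        6 + (19695165399105536 / 2460375) * s ^ 4 * r ^ 5 + (19300331271749632 / 2460375) * s ^
        5 * r ^ 4 + (12580223820234752 / 2460375) * s ^ 6 * r ^ 3 + (5257548387057664 / 2460375)
        * s ^ 7 * r ^ 2 + (255519952470016 / 492075) * s ^ 8 * r + (137421773602816 / 2460375) *
        s ^ 9 := by
        positivity
      refine h.trans_eq ?_
      rw [hs, hr]
      ring

theorem critical_certificate_six {y : ℝ} (h₁ : -1 ≤ y) (h₂ : y ≤ 1) :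
    0 ≤ (108611 / 189000) + (1688 / 315) * y + (4408 / 63) * y ^ 2 + (-3800 / 63) * y ^ 3 + (-8024
      / 135) * y ^ 4 + (11776 / 63) * y ^ 5 + (-495904 / 945) * y ^ 6 + (70528 / 315) * y ^ 7 +
      (273536 / 189) * y ^ 8 + (-715264 / 315) * y ^ 9 + (183296 / 315) * y ^ 10 + (47104 / 35)
      * y ^ 11 + (-149504 / 105) * y ^ 12 + (180224 / 315) * y ^ 13 + (-16384 / 189) * y ^ 14 := by
  rcases le_total y (0) with h₃ | h₃
  · obtain ⟨s, hs⟩ : ∃ s, s = y - (-1) := ⟨_, rfl⟩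
    obtain ⟨r, hr⟩ : ∃ r, r = 0 - y := ⟨_, rfl⟩
    have hs₀ : 0 ≤ s := by linarith
    have hr₀ : 0 ≤ r := by linarith
    have h : 0 ≤ (12793 / 7000) * r ^ 14 + (784987477 / 94500) * s * r ^ 13 + (1336643867 / 63000) * s ^ 2
      * r ^ 12 + (784302401 / 47250) * s ^ 3 * r ^ 11 + (817129211 / 189000) * s ^ 4 * r ^ 10 +
      (214255373 / 13500) * s ^ 5 * r ^ 9 + (2649206011 / 63000) * s ^ 6 * r ^ 8 + (1176824119 /
      23625) * s ^ 7 * r ^ 7 + (6526920433 / 189000) * s ^ 8 * r ^ 6 + (1440951611 / 94500) * s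
      ^ 9 * r ^ 5 + (4264599 / 1000) * s ^ 10 * r ^ 4 + (4665143 / 6750) * s ^ 11 * r ^ 3 +
      (9941201 / 189000) * s ^ 12 * r ^ 2 + (253877 / 94500) * s ^ 13 * r + (108611 / 189000) *
      s ^ 14 := by
      positivity
    refine h.trans_eq ?_
    rw [hs, hr]
    ring
  · obtain ⟨s, hs⟩ : ∃ s, s = y - (0) := ⟨_, rfl⟩
    obtain ⟨r, hr⟩ : ∃ r, r = 1 - y := ⟨_, rfl⟩
    have hs₀ : 0 ≤ s := by linarith
    have hr₀ : 0 ≤ r := by linarith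
    have h : 0 ≤ (108611 / 189000) * r ^ 14 + (1266677 / 94500) * s * r ^ 13 + (36274001 / 189000) * s ^ 2
      * r ^ 12 + (66455201 / 47250) * s ^ 3 * r ^ 11 + (126058979 / 21000) * s ^ 4 * r ^ 10 +
      (1573431611 / 94500) * s ^ 5 * r ^ 9 + (6007771633 / 189000) * s ^ 6 * r ^ 8 + (999346519
      / 23625) * s ^ 7 * r ^ 7 + (2472495611 / 63000) * s ^ 8 * r ^ 6 + (2447283611 / 94500) * s
      ^ 9 * r ^ 5 + (2314681211 / 189000) * s ^ 10 * r ^ 4 + (194341601 / 47250) * s ^ 11 * r ^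
      3 + (19761289 / 21000) * s ^ 12 * r ^ 2 + (12350677 / 94500) * s ^ 13 * r + (511937 /
      63000) * s ^ 14 := by
      positivity
    refine h.trans_eq ?_
    rw [hs, hr]
    ring

/-- The real parts of the powers of `e^{iθ}` as Chebyshev polynomials in `cos θ`. -/
theorem re_exp_pow_chebyshev (θ : ℝ) :
    ∀ n : ℕ, (Complex.exp (θ * Complex.I) ^ n).re
      = (Polynomial.Chebyshev.T ℝ n).eval (Real.cos θ) := by
  intro n
  rw [re_exp_pow, Polynomial.Chebyshev.T_real_cos]
  simp

theorem chebyshev_recurrence (x : ℝ) (n : ℕ) :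
    (Polynomial.Chebyshev.T ℝ ((n + 2 : ℕ) : ℤ)).eval x
      = 2 * x * (Polynomial.Chebyshev.T ℝ ((n + 1 : ℕ) : ℤ)).eval x
        - (Polynomial.Chebyshev.T ℝ (n : ℤ)).eval x := by
  push_cast
  rw [Polynomial.Chebyshev.T_add_two]
  simp

/-- Index 16 is the largest needed: for `q = 6` the product `νA(1 + G/63)` has degree `4 + 6 + 6`.
-/
theorem chebyshev_values {c : ℕ → ℝ} {y : ℝ} (k0 : c 0 = 1) (k1 : c 1 = y)
    (hstep : ∀ n, c (n + 2) = 2 * y * c (n + 1) - c n) :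
    c 2 = (-1) + (2) * y ^ 2 ∧
    c 3 = (-3) * y + (4) * y ^ 3 ∧
    c 4 = (1) + (-8) * y ^ 2 + (8) * y ^ 4 ∧
    c 5 = (5) * y + (-20) * y ^ 3 + (16) * y ^ 5 ∧
    c 6 = (-1) + (18) * y ^ 2 + (-48) * y ^ 4 + (32) * y ^ 6 ∧
    c 7 = (-7) * y + (56) * y ^ 3 + (-112) * y ^ 5 + (64) * y ^ 7 ∧
    c 8 = (1) + (-32) * y ^ 2 + (160) * y ^ 4 + (-256) * y ^ 6 + (128) * y ^ 8 ∧
    c 9 = (9) * y + (-120) * y ^ 3 + (432) * y ^ 5 + (-576) * y ^ 7 + (256) * y ^ 9 ∧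
    c 10 = (-1) + (50) * y ^ 2 + (-400) * y ^ 4 + (1120) * y ^ 6 + (-1280) * y ^ 8 + (512) * y ^ 10 ∧
    c 11 = (-11) * y + (220) * y ^ 3 + (-1232) * y ^ 5 + (2816) * y ^ 7 + (-2816) * y ^ 9 + (1024) *
      y ^ 11 ∧
    c 12 = (1) + (-72) * y ^ 2 + (840) * y ^ 4 + (-3584) * y ^ 6 + (6912) * y ^ 8 + (-6144) * y ^ 10
      + (2048) * y ^ 12 ∧
    c 13 = (13) * y + (-364) * y ^ 3 + (2912) * y ^ 5 + (-9984) * y ^ 7 + (16640) * y ^ 9 + (-13312)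
      * y ^ 11 + (4096) * y ^ 13 ∧
    c 14 = (-1) + (98) * y ^ 2 + (-1568) * y ^ 4 + (9408) * y ^ 6 + (-26880) * y ^ 8 + (39424) * y ^
      10 + (-28672) * y ^ 12 + (8192) * y ^ 14 ∧
    c 15 = (-15) * y + (560) * y ^ 3 + (-6048) * y ^ 5 + (28800) * y ^ 7 + (-70400) * y ^ 9 + (92160)
      * y ^ 11 + (-61440) * y ^ 13 + (16384) * y ^ 15 ∧
    c 16 = (1) + (-128) * y ^ 2 + (2688) * y ^ 4 + (-21504) * y ^ 6 + (84480) * y ^ 8 + (-180224) * y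
      ^ 10 + (212992) * y ^ 12 + (-131072) * y ^ 14 + (32768) * y ^ 16 := by
  have k2 : c 2 = (-1) + (2) * y ^ 2 := by
    rw [hstep 0, k1, k0]
    ring
  have k3 : c 3 = (-3) * y + (4) * y ^ 3 := by
    rw [hstep 1, k2, k1]
    ring
  have k4 : c 4 = (1) + (-8) * y ^ 2 + (8) * y ^ 4 := by
    rw [hstep 2, k3, k2]
    ring
  have k5 : c 5 = (5) * y + (-20) * y ^ 3 + (16) * y ^ 5 := by
    rw [hstep 3, k4, k3]
    ring
  have k6 : c 6 = (-1) + (18) * y ^ 2 + (-48) * y ^ 4 + (32) * y ^ 6 := by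
    rw [hstep 4, k5, k4]
    ring
  have k7 : c 7 = (-7) * y + (56) * y ^ 3 + (-112) * y ^ 5 + (64) * y ^ 7 := by
    rw [hstep 5, k6, k5]
    ring
  have k8 : c 8 = (1) + (-32) * y ^ 2 + (160) * y ^ 4 + (-256) * y ^ 6 + (128) * y ^ 8 := by
    rw [hstep 6, k7, k6]
    ring
  have k9 : c 9 = (9) * y + (-120) * y ^ 3 + (432) * y ^ 5 + (-576) * y ^ 7 + (256) * y ^ 9 := by
    rw [hstep 7, k8, k7]
    ring
  have k10 : c 10 = (-1) + (50) * y ^ 2 + (-400) * y ^ 4 + (1120) * y ^ 6 + (-1280) * y ^ 8 + (512) * y ^ 10 := by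
    rw [hstep 8, k9, k8]
    ring
  have k11 : c 11 = (-11) * y + (220) * y ^ 3 + (-1232) * y ^ 5 + (2816) * y ^ 7 + (-2816) * y ^ 9 + (1024) *
      y ^ 11 := by
    rw [hstep 9, k10, k9]
    ring
  have k12 : c 12 = (1) + (-72) * y ^ 2 + (840) * y ^ 4 + (-3584) * y ^ 6 + (6912) * y ^ 8 + (-6144) * y ^ 10
      + (2048) * y ^ 12 := by
    rw [hstep 10, k11, k10]
    ring
  have k13 : c 13 = (13) * y + (-364) * y ^ 3 + (2912) * y ^ 5 + (-9984) * y ^ 7 + (16640) * y ^ 9 + (-13312)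
      * y ^ 11 + (4096) * y ^ 13 := by
    rw [hstep 11, k12, k11]
    ring
  have k14 : c 14 = (-1) + (98) * y ^ 2 + (-1568) * y ^ 4 + (9408) * y ^ 6 + (-26880) * y ^ 8 + (39424) * y ^
      10 + (-28672) * y ^ 12 + (8192) * y ^ 14 := by
    rw [hstep 12, k13, k12]
    ring
  have k15 : c 15 = (-15) * y + (560) * y ^ 3 + (-6048) * y ^ 5 + (28800) * y ^ 7 + (-70400) * y ^ 9 + (92160)
      * y ^ 11 + (-61440) * y ^ 13 + (16384) * y ^ 15 := by
    rw [hstep 13, k14, k13]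
    ring
  have k16 : c 16 = (1) + (-128) * y ^ 2 + (2688) * y ^ 4 + (-21504) * y ^ 6 + (84480) * y ^ 8 + (-180224) * y
      ^ 10 + (212992) * y ^ 12 + (-131072) * y ^ 14 + (32768) * y ^ 16 := by
    rw [hstep 14, k15, k14]
    ring
  exact ⟨k2, k3, k4, k5, k6, k7, k8, k9, k10, k11, k12, k13, k14, k15, k16⟩

theorem exists_multiplier_four : ∃ ν : ℝ[X], ∃ c : ℝ, 0 < c ∧ ∀ θ,
    0 ≤ symbolRe ν θ ∧ c * Real.sin θ ^ 2 ≤ symbolRe (ν * bdfDiff 4) θ ∧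
      c * Real.sin θ ^ 2 ≤
        symbolRe (ν * bdfDiff 4 * (1 + C (1 / (2 ^ 4 - 1)) * bdfExtrap 4)) θ := by
  -- The constant `1/1000` is the slack built into the two `sin²` certificates.
  refine ⟨C 2 + C 1 * X, 1 / 1000, by norm_num, fun θ => ?_⟩
  have hT := re_exp_pow_chebyshev θ
  have hrec := chebyshev_recurrence (Real.cos θ)
  have h₁ := Real.neg_one_le_cos θ
  have h₂ := Real.cos_le_one θ
  have hs := Real.sin_sq θ
  unfold symbolRe bdfDiff bdfExtrap
  generalize Complex.exp (θ * Complex.I) = z at hT ⊢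
  generalize Real.cos θ = y at *
  rw [hs]
  have k0 : (z ^ 0).re = 1 := by simp
  have k1 : (z ^ 1).re = y := by rw [hT]; simp
  obtain ⟨k2, k3, k4, k5, k6, k7, k8, k9, k10, k11, k12, k13, k14, k15, k16⟩ :=
    chebyshev_values (c := fun n => (z ^ n).re) k0 k1 fun n => by simp only [hT, hrec]
  have hre : ∀ (r : ℝ) (w : ℂ), ((r : ℂ) * w).re = r * w.re := fun r w => by simp
  refine ⟨?_, ?_, ?_⟩
  · have hz : aeval z (C 2 + C 1 * X : ℝ[X]) = ((2 : ℝ) : ℂ) * z ^ 0 + ((1 : ℝ) : ℂ) * z ^ 1 := by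
      simp
    rw [hz]
    simp only [Complex.add_re, hre, k0, k1]
    have h := multiplier_certificate_four h₁ h₂
    linarith
  · have hz : aeval z ((C 2 + C 1 * X) * (∑ j ∈ Finset.Icc (1 : ℕ) 4, C (1 / (j : ℝ)) * (1 - X) ^ j : ℝ[X]) : ℝ[X]) = ((25 / 6 : ℝ) : ℂ) * z ^ 0 + ((-71 / 12 : ℝ) : ℂ) * z ^ 1 + ((2 : ℝ) : ℂ) * z ^ 2 + ((1 /
      3 : ℝ) : ℂ) * z ^ 3 + ((-5 / 6 : ℝ) : ℂ) * z ^ 4 + ((1 / 4 : ℝ) : ℂ) * z ^ 5 := by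
      simp [Finset.sum_Icc_succ_top]
      ring
    rw [hz]
    simp only [Complex.add_re, hre, k0, k1, k2, k3, k4, k5]
    have h := mul_nonneg (sub_nonneg.2 h₂) (implicit_certificate_four h₁ h₂)
    linarith
  · have hz : aeval z ((C 2 + C 1 * X) * (∑ j ∈ Finset.Icc (1 : ℕ) 4, C (1 / (j : ℝ)) * (1 - X) ^ j : ℝ[X]) *
        (1 + C (1 / (2 ^ 4 - 1)) * (1 - (1 - X) ^ 4)) : ℝ[X]) = ((25 / 6 : ℝ) : ℂ) * z ^ 0 + ((-173 / 36 : ℝ) : ℂ) * z ^ 1 + ((-56 / 45 : ℝ) : ℂ) * z ^ 2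
      + ((391 / 90 : ℝ) : ℂ) * z ^ 3 + ((-17 / 5 : ℝ) : ℂ) * z ^ 4 + ((37 / 45 : ℝ) : ℂ) * z ^ 5
      + ((16 / 45 : ℝ) : ℂ) * z ^ 6 + ((-31 / 90 : ℝ) : ℂ) * z ^ 7 + ((11 / 90 : ℝ) : ℂ) * z ^ 8
      + ((-1 / 60 : ℝ) : ℂ) * z ^ 9 := by
      simp [Finset.sum_Icc_succ_top]
      ring
    rw [hz]
    simp only [Complex.add_re, hre, k0, k1, k2, k3, k4, k5, k6, k7, k8, k9]
    have h := mul_nonneg (mul_nonneg (sub_nonneg.2 h₂) (neg_le_iff_add_nonneg'.1 h₁)) (critical_certificate_four h₁ h₂)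
    linarith

theorem exists_multiplier_five : ∃ ν : ℝ[X], ∃ c : ℝ, 0 < c ∧ ∀ θ,
    0 ≤ symbolRe ν θ ∧ c * Real.sin θ ^ 2 ≤ symbolRe (ν * bdfDiff 5) θ ∧
      c * Real.sin θ ^ 2 ≤
        symbolRe (ν * bdfDiff 5 * (1 + C (1 / (2 ^ 5 - 1)) * bdfExtrap 5)) θ := by
  refine ⟨C 2 + C 2 * X + C 1 * X ^ 2, 1 / 1000, by norm_num, fun θ => ?_⟩
  have hT := re_exp_pow_chebyshev θ
  have hrec := chebyshev_recurrence (Real.cos θ)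
  have h₁ := Real.neg_one_le_cos θ
  have h₂ := Real.cos_le_one θ
  have hs := Real.sin_sq θ
  unfold symbolRe bdfDiff bdfExtrap
  generalize Complex.exp (θ * Complex.I) = z at hT ⊢
  generalize Real.cos θ = y at *
  rw [hs]
  have k0 : (z ^ 0).re = 1 := by simp
  have k1 : (z ^ 1).re = y := by rw [hT]; simp
  obtain ⟨k2, k3, k4, k5, k6, k7, k8, k9, k10, k11, k12, k13, k14, k15, k16⟩ :=
    chebyshev_values (c := fun n => (z ^ n).re) k0 k1 fun n => by simp only [hT, hrec]
  have hre : ∀ (r : ℝ) (w : ℂ), ((r : ℂ) * w).re = r * w.re := fun r w => by simp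
  refine ⟨?_, ?_, ?_⟩
  · have hz : aeval z (C 2 + C 2 * X + C 1 * X ^ 2 : ℝ[X]) = ((2 : ℝ) : ℂ) * z ^ 0 + ((2 : ℝ) : ℂ) * z ^ 1 + ((1 : ℝ) : ℂ) * z ^ 2 := by
      simp
    rw [hz]
    simp only [Complex.add_re, hre, k0, k1, k2]
    have h := multiplier_certificate_five h₁ h₂
    linarith
  · have hz : aeval z ((C 2 + C 2 * X + C 1 * X ^ 2) * (∑ j ∈ Finset.Icc (1 : ℕ) 5, C (1 / (j : ℝ)) * (1 - X) ^ j : ℝ[X]) : ℝ[X]) = ((137 / 30 : ℝ) : ℂ) * z ^ 0 + ((-163 / 30 : ℝ) : ℂ) * z ^ 1 + ((137 / 60 : ℝ) : ℂ) * z ^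
      2 + ((-5 / 3 : ℝ) : ℂ) * z ^ 3 + ((5 / 6 : ℝ) : ℂ) * z ^ 4 + ((-37 / 30 : ℝ) : ℂ) * z ^ 5
      + ((17 / 20 : ℝ) : ℂ) * z ^ 6 + ((-1 / 5 : ℝ) : ℂ) * z ^ 7 := by
      simp [Finset.sum_Icc_succ_top]
      ring
    rw [hz]
    simp only [Complex.add_re, hre, k0, k1, k2, k3, k4, k5, k6, k7]
    have h := mul_nonneg (sub_nonneg.2 h₂) (implicit_certificate_five h₁ h₂)
    linarith
  · have hz : aeval z ((C 2 + C 2 * X + C 1 * X ^ 2) * (∑ j ∈ Finset.Icc (1 : ℕ) 5, C (1 / (j : ℝ)) * (1 - X) ^ j : ℝ[X]) *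
        (1 + C (1 / (2 ^ 5 - 1)) * (1 - (1 - X) ^ 5)) : ℝ[X]) = ((137 / 30 : ℝ) : ℂ) * z ^ 0 + ((-728 / 155 : ℝ) : ℂ) * z ^ 1 + ((-41 / 620 : ℝ) : ℂ) * z
      ^ 2 + ((239 / 124 : ℝ) : ℂ) * z ^ 3 + ((-165 / 62 : ℝ) : ℂ) * z ^ 4 + ((223 / 186 : ℝ) :
      ℂ) * z ^ 5 + ((-65 / 93 : ℝ) : ℂ) * z ^ 6 + ((88 / 93 : ℝ) : ℂ) * z ^ 7 + ((-83 / 93 : ℝ)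
      : ℂ) * z ^ 8 + ((35 / 62 : ℝ) : ℂ) * z ^ 9 + ((-449 / 1860 : ℝ) : ℂ) * z ^ 10 + ((37 / 620
      : ℝ) : ℂ) * z ^ 11 + ((-1 / 155 : ℝ) : ℂ) * z ^ 12 := by
      simp [Finset.sum_Icc_succ_top]
      ring
    rw [hz]
    simp only [Complex.add_re, hre, k0, k1, k2, k3, k4, k5, k6, k7, k8, k9, k10, k11, k12]
    have h := mul_nonneg (mul_nonneg (sub_nonneg.2 h₂) (neg_le_iff_add_nonneg'.1 h₁)) (critical_certificate_five h₁ h₂)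
    linarith

theorem exists_multiplier_six : ∃ ν : ℝ[X], ∃ c : ℝ, 0 < c ∧ ∀ θ,
    0 ≤ symbolRe ν θ ∧ c * Real.sin θ ^ 2 ≤ symbolRe (ν * bdfDiff 6) θ ∧
      c * Real.sin θ ^ 2 ≤
        symbolRe (ν * bdfDiff 6 * (1 + C (1 / (2 ^ 6 - 1)) * bdfExtrap 6)) θ := by
  refine ⟨C 5 + C 6 * X + C 3 * X ^ 2 + C (-1) * X ^ 4, 1 / 1000, by norm_num, fun θ => ?_⟩
  have hT := re_exp_pow_chebyshev θ
  have hrec := chebyshev_recurrence (Real.cos θ)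
  have h₁ := Real.neg_one_le_cos θ
  have h₂ := Real.cos_le_one θ
  have hs := Real.sin_sq θ
  unfold symbolRe bdfDiff bdfExtrap
  generalize Complex.exp (θ * Complex.I) = z at hT ⊢
  generalize Real.cos θ = y at *
  rw [hs]
  have k0 : (z ^ 0).re = 1 := by simp
  have k1 : (z ^ 1).re = y := by rw [hT]; simp
  obtain ⟨k2, k3, k4, k5, k6, k7, k8, k9, k10, k11, k12, k13, k14, k15, k16⟩ :=
    chebyshev_values (c := fun n => (z ^ n).re) k0 k1 fun n => by simp only [hT, hrec]
  have hre : ∀ (r : ℝ) (w : ℂ), ((r : ℂ) * w).re = r * w.re := fun r w => by simp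
  refine ⟨?_, ?_, ?_⟩
  · have hz : aeval z (C 5 + C 6 * X + C 3 * X ^ 2 + C (-1) * X ^ 4 : ℝ[X]) = ((5 : ℝ) : ℂ) * z ^ 0 + ((6 : ℝ) : ℂ) * z ^ 1 + ((3 : ℝ) : ℂ) * z ^ 2 + ((-1 : ℝ) : ℂ) * z
      ^ 4 := by
      simp
    rw [hz]
    simp only [Complex.add_re, hre, k0, k1, k2, k4]
    have h := multiplier_certificate_six h₁ h₂
    linarith
  · have hz : aeval z ((C 5 + C 6 * X + C 3 * X ^ 2 + C (-1) * X ^ 4) * (∑ j ∈ Finset.Icc (1 : ℕ) 6, C (1 / (j : ℝ)) * (1 - X) ^ j : ℝ[X]) : ℝ[X]) = ((49 / 4 : ℝ) : ℂ) * z ^ 0 + ((-153 / 10 : ℝ) : ℂ) * z ^ 1 + ((177 / 20 : ℝ) : ℂ) * z ^ 2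
      + ((-19 / 3 : ℝ) : ℂ) * z ^ 3 + ((-6 / 5 : ℝ) : ℂ) * z ^ 4 + ((5 / 2 : ℝ) : ℂ) * z ^ 5 +
      ((-157 / 60 : ℝ) : ℂ) * z ^ 6 + ((61 / 15 : ℝ) : ℂ) * z ^ 7 + ((-13 / 4 : ℝ) : ℂ) * z ^ 8
      + ((6 / 5 : ℝ) : ℂ) * z ^ 9 + ((-1 / 6 : ℝ) : ℂ) * z ^ 10 := by
      simp [Finset.sum_Icc_succ_top]
      ring
    rw [hz]
    simp only [Complex.add_re, hre, k0, k1, k2, k3, k4, k5, k6, k7, k8, k9, k10]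
    have h := mul_nonneg (sub_nonneg.2 h₂) (implicit_certificate_six h₁ h₂)
    linarith
  · have hz : aeval z ((C 5 + C 6 * X + C 3 * X ^ 2 + C (-1) * X ^ 4) * (∑ j ∈ Finset.Icc (1 : ℕ) 6, C (1 / (j : ℝ)) * (1 - X) ^ j : ℝ[X]) *
        (1 + C (1 / (2 ^ 6 - 1)) * (1 - (1 - X) ^ 6)) : ℝ[X]) = ((49 / 4 : ℝ) : ℂ) * z ^ 0 + ((-212 / 15 : ℝ) : ℂ) * z ^ 1 + ((94 / 21 : ℝ) : ℂ) * z ^ 2 +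
      ((643 / 315 : ℝ) : ℂ) * z ^ 3 + ((-7361 / 630 : ℝ) : ℂ) * z ^ 4 + ((7253 / 630 : ℝ) : ℂ) *
      z ^ 5 + ((-29719 / 3780 : ℝ) : ℂ) * z ^ 6 + ((1712 / 315 : ℝ) : ℂ) * z ^ 7 + ((-2399 /
      1260 : ℝ) : ℂ) * z ^ 8 + ((-478 / 315 : ℝ) : ℂ) * z ^ 9 + ((781 / 270 : ℝ) : ℂ) * z ^ 10 +
      ((-272 / 105 : ℝ) : ℂ) * z ^ 11 + ((1534 / 945 : ℝ) : ℂ) * z ^ 12 + ((-449 / 630 : ℝ) : ℂ)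
      * z ^ 13 + ((37 / 180 : ℝ) : ℂ) * z ^ 14 + ((-11 / 315 : ℝ) : ℂ) * z ^ 15 + ((1 / 378 : ℝ)
      : ℂ) * z ^ 16 := by
      simp [Finset.sum_Icc_succ_top]
      ring
    rw [hz]
    simp only [Complex.add_re, hre, k0, k1, k2, k3, k4, k5, k6, k7, k8, k9, k10, k11, k12, k13, k14, k15, k16]
    have h := mul_nonneg (mul_nonneg (sub_nonneg.2 h₂) (neg_le_iff_add_nonneg'.1 h₁)) (critical_certificate_six h₁ h₂)
    linarith

/-- A single `ν` has to serve all three bounds, because `B` is multiplied by `ν` alone while `C` and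
`M` are multiplied by `νA` and `νAG`. -/
theorem exists_multiplier {q : ℕ} (hq : q = 4 ∨ q = 5 ∨ q = 6) :
    ∃ ν : ℝ[X], ∃ c : ℝ, 0 < c ∧ ∀ θ,
      0 ≤ symbolRe ν θ ∧ c * Real.sin θ ^ 2 ≤ symbolRe (ν * bdfDiff q) θ ∧
      c * Real.sin θ ^ 2 ≤
        symbolRe (ν * bdfDiff q * (1 + C (1 / (2 ^ q - 1)) * bdfExtrap q)) θ := by
  rcases hq with rfl | rfl | rfl
  · exact exists_multiplier_four
  · exact exists_multiplier_five
  · exact exists_multiplier_six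

/-! ### Degrees, and the scheme rewritten as causal convolutions. -/

theorem natDegree_one_sub_X_pow_le (j : ℕ) : ((1 - X : ℝ[X]) ^ j).natDegree ≤ j := by
  compute_degree

theorem natDegree_bdfDiff_le (q : ℕ) : (bdfDiff q).natDegree ≤ q := by
  refine natDegree_sum_le_of_forall_le _ _ fun j hj => ?_
  exact (natDegree_C_mul_le _ _).trans
    ((natDegree_one_sub_X_pow_le j).trans (Finset.mem_Icc.1 hj).2)

theorem natDegree_bdfExtrap_le (q : ℕ) : (bdfExtrap q).natDegree ≤ q := by
  unfold bdfExtrap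
  compute_degree

theorem natDegree_bdfAlpha_le (q : ℕ) : (bdfAlpha q).natDegree ≤ q := by
  refine natDegree_sum_le_of_forall_le _ _ fun j hj => ?_
  have h : (C (1 / (j : ℝ)) * X ^ (q - j) * (X - 1) ^ j).natDegree ≤ (q - j) + j := by
    compute_degree
  exact h.trans (by have := Finset.mem_Icc.1 hj; omega)

/-- The leading terms of the two monic polynomials cancel; this is what makes the treatment of `M`
explicit. -/
theorem natDegree_bdfGamma_lt {q : ℕ} (hq : 1 ≤ q) : (bdfGamma q).natDegree < q := by
  have h1 : ((X - 1 : ℝ[X]) ^ q).Monic := by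
    rw [← C_1]
    exact (monic_X_sub_C 1).pow q
  have h2 : ((X - 1 : ℝ[X]) ^ q).natDegree = q := by
    rw [← C_1, (monic_X_sub_C (1 : ℝ)).natDegree_pow, natDegree_X_sub_C, mul_one]
  unfold bdfGamma
  by_cases h0 : (X ^ q - (X - 1) ^ q : ℝ[X]) = 0
  · rw [h0, natDegree_zero]
    omega
  · refine (natDegree_lt_iff_degree_lt h0).2 ?_
    have h3 : (X ^ q : ℝ[X]).degree = q := by simp
    rw [← h3]
    refine degree_sub_lt_left ?_ (pow_ne_zero _ X_ne_zero) ?_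
    · rw [h3, degree_eq_natDegree h1.ne_zero, h2]
    · rw [h1.leadingCoeff, (monic_X_pow q).leadingCoeff]

section Scheme

variable {E : Type*} [AddCommGroup E] [Module ℝ E]

theorem fwdShift_sub_one_pow (j : ℕ) :
    (fwdShift E - 1) ^ j = fwdShift E ^ j * (1 - backShift E) ^ j := by
  have h : fwdShift E - 1 = fwdShift E * (1 - backShift E) := by
    rw [mul_sub, mul_one, fwdShift_mul_backShift]
  rw [h, Commute.mul_pow]
  exact (Commute.one_right _).sub_right commute_fwdShift_backShift

/-- The operator form of `α(ζ) = ζ^q A(1/ζ)`, since the two shifts are mutually inverse. -/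
theorem aeval_fwdShift_bdfAlpha (q : ℕ) :
    aeval (fwdShift E) (bdfAlpha q) = fwdShift E ^ q * aeval (backShift E) (bdfDiff q) := by
  rw [bdfAlpha, bdfDiff, map_sum, map_sum, Finset.mul_sum]
  refine Finset.sum_congr rfl fun j hj => ?_
  have hj' : q = (q - j) + j := by have := Finset.mem_Icc.1 hj; omega
  simp only [map_mul, map_pow, map_sub, map_one, aeval_X, aeval_C, fwdShift_sub_one_pow]
  nth_rw 2 [hj']
  rw [pow_add, ← mul_assoc, ← mul_assoc, mul_assoc (algebraMap _ _ _)]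
  rw [Algebra.commutes]

theorem aeval_fwdShift_bdfGamma (q : ℕ) :
    aeval (fwdShift E) (bdfGamma q) = fwdShift E ^ q * aeval (backShift E) (bdfExtrap q) := by
  simp only [bdfGamma, bdfExtrap, map_sub, map_pow, map_one, aeval_X, fwdShift_sub_one_pow,
    mul_sub, mul_one]

theorem commute_fwdShift_aeval_backShift (κ : ℝ[X]) :
    Commute (fwdShift E) (aeval (backShift E) κ) := by
  induction κ using Polynomial.induction_on' with
  | add p q hp hq => rw [map_add]; exact hp.add_right hq
  | monomial n a =>
    rw [aeval_monomial]
    have h : Commute (fwdShift E) (algebraMap ℝ _ a) := (Algebra.commutes a (fwdShift E)).symm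
    exact h.mul_right (commute_fwdShift_backShift.pow_right n)

theorem sum_bdfGamma {q : ℕ} (hq : 1 ≤ q) (y : ℤ → E) (n : ℤ) :
    ∑ i ∈ Finset.range q, (bdfGamma q).coeff i • y (n - q + i) = conv (bdfExtrap q) y n := by
  rw [← aeval_fwdShift_apply (natDegree_bdfGamma_lt hq), aeval_fwdShift_bdfGamma,
    Module.End.mul_apply, fwdShift_pow_apply, sub_add_cancel, conv]

theorem sum_bdfAlphaTilde (q : ℕ) (y : ℤ → E) (n : ℤ) :
    ∑ i ∈ Finset.range (2 * q + 1), (bdfAlphaTilde q).coeff i • y (n - 2 * q + i)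
      = conv (bdfDiff q) y n := by
  have h : (bdfAlphaTilde q).natDegree < 2 * q + 1 := by
    have h1 := natDegree_mul_le (p := bdfAlpha q) (q := bdfBeta q)
    have h2 := natDegree_bdfAlpha_le q
    have h3 : (bdfBeta q).natDegree = q := by simp [bdfBeta]
    unfold bdfAlphaTilde
    omega
  rw [← aeval_fwdShift_apply h, bdfAlphaTilde, mul_comm, map_mul, aeval_fwdShift_bdfAlpha, bdfBeta,
    map_pow, aeval_X, ← mul_assoc, ← pow_add, Module.End.mul_apply, fwdShift_pow_apply, conv]
  push_cast
  rw [← two_mul, sub_add_cancel]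

theorem sum_bdfAlphaHat {q : ℕ} (hq : 1 ≤ q) (y : ℤ → E) (n : ℤ) :
    ∑ i ∈ Finset.range (2 * q), (bdfAlphaHat q).coeff i • y (n - 2 * q + i)
      = conv (bdfDiff q * bdfExtrap q) y n := by
  have h : (bdfAlphaHat q).natDegree < 2 * q := by
    have h1 := natDegree_mul_le (p := bdfAlpha q) (q := bdfGamma q)
    have h2 := natDegree_bdfAlpha_le q
    have h3 := natDegree_bdfGamma_lt hq
    unfold bdfAlphaHat
    omega
  have hcomm := ((commute_fwdShift_aeval_backShift (E := E) (bdfDiff q)).pow_left q).eq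
  rw [← aeval_fwdShift_apply h, bdfAlphaHat, map_mul, aeval_fwdShift_bdfAlpha,
    aeval_fwdShift_bdfGamma, mul_assoc, ← mul_assoc (aeval _ (bdfDiff q)), ← hcomm, mul_assoc,
    ← map_mul, ← mul_assoc, ← pow_add, Module.End.mul_apply, fwdShift_pow_apply, conv]
  push_cast
  rw [← two_mul, sub_add_cancel]

end Scheme

/-! ### Consistency of the BDF differences. -/

section Consistency

variable {E : Type*} [NormedAddCommGroup E] [NormedSpace ℝ E]

/-- Taylor expansion of a function and of its derivative, with remainders controlled by the
Lipschitz constant of the last derivative. -/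
theorem HasBoundedNextDeriv.exists_taylor {k : ℕ} {K : ℝ≥0} {s : Set ℝ} (hs : Convex ℝ s)
    (hu : UniqueDiffOn ℝ s) {v : ℝ → E} (h : HasBoundedNextDeriv k K s v) {t : ℝ} (ht : t ∈ s) :
    ∃ w : ℕ → E, ∀ x ∈ s, t ≤ x →
      ‖v x - ∑ i ∈ Finset.range (k + 1), (x - t) ^ i • w i‖ ≤ K * (x - t) ^ (k + 1) ∧
      (1 ≤ k → ‖derivWithin v s x - ∑ i ∈ Finset.range k, ((i + 1) * (x - t) ^ i) • w (i + 1)‖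
        ≤ K * (x - t) ^ k) := by
  induction k generalizing v with
  | zero =>
    refine ⟨fun _ => v t, fun x hx htx => ⟨?_, fun h => absurd h (by norm_num)⟩⟩
    have := h.2.dist_le_mul x hx t ht
    simpa [iteratedDerivWithin_zero, dist_eq_norm, Real.norm_eq_abs,
      abs_of_nonneg (sub_nonneg.2 htx)] using this
  | succ k ih =>
    have hcd : ContDiffOn ℝ ((k : ℕ∞) + 1 : ℕ∞) v s := by exact_mod_cast h.1
    have hd : DifferentiableOn ℝ v s := h.1.differentiableOn (by simp)
    have h' : HasBoundedNextDeriv k K s (derivWithin v s) := by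
      refine ⟨?_, ?_⟩
      · refine h.1.derivWithin hu ?_
        norm_cast
      · have h2 := h.2
        rwa [iteratedDerivWithin_succ'] at h2
    obtain ⟨w, hw⟩ := ih h'
    -- Termwise integration of the Taylor polynomial of the derivative, with constant term `v t`.
    let w' : ℕ → E := fun i => Nat.casesOn i (v t) fun i => ((i : ℝ) + 1)⁻¹ • w i
    have hder : ∀ x, ∑ i ∈ Finset.range (k + 1), (((i : ℝ) + 1) * (x - t) ^ i) • w' (i + 1)
        = ∑ i ∈ Finset.range (k + 1), (x - t) ^ i • w i := by
      intro x
      refine Finset.sum_congr rfl fun i _ => ?_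
      have : (i : ℝ) + 1 ≠ 0 := by positivity
      simp only [w', smul_smul]
      congr 1
      field_simp
    refine ⟨w', fun x hx htx => ⟨?_, fun _ => ?_⟩⟩
    · set P : ℝ → E := fun z => ∑ i ∈ Finset.range (k + 1 + 1), (z - t) ^ i • w' i with hP
      have hPd : ∀ z, HasDerivAt P (∑ i ∈ Finset.range (k + 1), (z - t) ^ i • w i) z := by
        intro z
        rw [← hder z]
        have e : P = fun z => (∑ i ∈ Finset.range (k + 1), (z - t) ^ (i + 1) • w' (i + 1))
            + w' 0 := by
          funext z
          simp [hP, Finset.sum_range_succ' _ (k + 1)]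
        rw [e]
        refine HasDerivAt.add_const _ (HasDerivAt.fun_sum fun i _ => ?_)
        refine HasDerivAt.smul_const ?_ _
        have := ((hasDerivAt_id z).sub_const t).fun_pow (i + 1)
        simpa using this
      have hsub : Set.Icc t x ⊆ s := hs.ordConnected.out ht hx
      -- The mean value inequality gains one factor `x - t`. It gives no factorial in the
      -- denominator, which is why the remainder constant stays `K` at each order.
      have hmvt := (convex_Icc t x).norm_image_sub_le_of_norm_hasDerivWithin_le
        (f := fun z => v z - P z)
        (f' := fun z => derivWithin v s z - ∑ i ∈ Finset.range (k + 1), (z - t) ^ i • w i)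
        (C := K * (x - t) ^ (k + 1)) (x := t) (y := x)
        (fun z hz => ((hd z (hsub hz)).hasDerivWithinAt.mono hsub).sub (hPd z).hasDerivWithinAt)
        (fun z hz => (hw z (hsub hz) hz.1).1.trans (by
          have := hz.1
          have := hz.2
          gcongr))
        (Set.left_mem_Icc.2 htx) (Set.right_mem_Icc.2 htx)
      have hPt : P t = v t := by
        simp [hP, Finset.sum_range_succ' _ (k + 1), w']
      rw [hPt, sub_self, sub_zero, Real.norm_eq_abs, abs_of_nonneg (sub_nonneg.2 htx)] at hmvt
      calc _ ≤ _ := hmvt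
        _ = _ := by ring
    · have := (hw x hx htx).1
      rw [← hder x] at this
      exact_mod_cast this

theorem conv_one_sub_X_pow_succ (j : ℕ) (y : ℤ → E) (n : ℤ) :
    conv ((1 - X) ^ (j + 1)) y n = conv ((1 - X) ^ j) y n - conv ((1 - X) ^ j) y (n - 1) := by
  rw [pow_succ', conv_mul]
  simp [conv, backShift_apply]

theorem conv_bdfDiff (q : ℕ) (y : ℤ → E) (n : ℤ) :
    conv (bdfDiff q) y n = ∑ j ∈ Finset.Icc 1 q, (1 / (j : ℝ)) • conv ((1 - X) ^ j) y n := by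
  simp only [bdfDiff, conv, map_sum, map_mul, aeval_C, LinearMap.sum_apply, Finset.sum_apply]
  rfl

/-- The order conditions of the BDF methods. -/
theorem conv_bdfDiff_pow {q : ℕ} (hq : q = 4 ∨ q = 5 ∨ q = 6) {i : ℕ} (hi : i < q) (τ : ℝ)
    (n : ℤ) :
    conv (bdfDiff q) (fun k : ℤ => (k * τ - (n - q) * τ) ^ (i + 1)) n
      = τ * ((i + 1) * (q * τ) ^ i) := by
  set y : ℤ → ℝ := fun k : ℤ => (k * τ - (n - q) * τ) ^ (i + 1) with hy
  -- Conceptually, `∑ (1/j) ∇^j` truncates `-log(1 - ∇) = τ d/dt`, and `∇^j` with `j > q` kills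
  -- polynomials of degree at most `q`. Here the backward differences are expanded binomially and
  -- each exponent is checked.
  have d0 : ∀ m, conv ((1 - X) ^ 0) y m = y m := fun m => by rw [pow_zero, conv_one]
  have hyv : ∀ j : ℕ, y (n - j) = ((q - j) * τ) ^ (i + 1) := by
    intro j
    simp only [hy]
    congr 1
    push_cast
    ring
  have y0 := hyv 0
  have y1 := hyv 1
  have y2 := hyv 2
  have y3 := hyv 3
  have y4 := hyv 4
  have y5 := hyv 5
  have y6 := hyv 6
  push_cast at y0 y1 y2 y3 y4 y5 y6
  rw [sub_zero] at y0
  have e : ∀ m : ℤ, ∀ a b : ℤ, m - a - b = m - (a + b) := fun m a b => by ring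
  have d1 : ∀ m, conv ((1 - X) ^ 1) y m
      = y m + (-1) * y (m - 1) := fun m => by
    rw [conv_one_sub_X_pow_succ, d0, d0]
    ring
  have d2 : ∀ m, conv ((1 - X) ^ 2) y m
      = y m + (-2) * y (m - 1) + (1) * y (m - 2) := fun m => by
    rw [conv_one_sub_X_pow_succ, d1, d1]
    simp only [e]
    norm_num
    ring
  have d3 : ∀ m, conv ((1 - X) ^ 3) y m
      = y m + (-3) * y (m - 1) + (3) * y (m - 2) + (-1) * y (m - 3) := fun m => by
    rw [conv_one_sub_X_pow_succ, d2, d2]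
    simp only [e]
    norm_num
    ring
  have d4 : ∀ m, conv ((1 - X) ^ 4) y m
      = y m + (-4) * y (m - 1) + (6) * y (m - 2) + (-4) * y (m - 3) + (1) * y (m - 4) := fun m => by
    rw [conv_one_sub_X_pow_succ, d3, d3]
    simp only [e]
    norm_num
    ring
  have d5 : ∀ m, conv ((1 - X) ^ 5) y m
      = y m + (-5) * y (m - 1) + (10) * y (m - 2)
        + (-10) * y (m - 3) + (5) * y (m - 4) + (-1) * y (m - 5) := fun m => by
    rw [conv_one_sub_X_pow_succ, d4, d4]
    simp only [e]
    norm_num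
    ring
  have d6 : ∀ m, conv ((1 - X) ^ 6) y m
      = y m + (-6) * y (m - 1) + (15) * y (m - 2)
        + (-20) * y (m - 3) + (15) * y (m - 4) + (-6) * y (m - 5) + (1) * y (m - 6) := fun m => by
    rw [conv_one_sub_X_pow_succ, d5, d5]
    simp only [e]
    norm_num
    ring
  rw [conv_bdfDiff]
  rcases hq with rfl | rfl | rfl
  all_goals
    simp only [Finset.sum_Icc_succ_top (Nat.le_add_left 1 _), Finset.Icc_self,
      Finset.sum_singleton, smul_eq_mul, Nat.reduceAdd, d1, d2, d3, d4, d5, d6,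
      y0, y1, y2, y3, y4, y5, y6]
    push_cast
    interval_cases i <;> push_cast <;> ring

/-- The consistency error of the implicit BDF methods. -/
theorem HasBoundedNextDeriv.norm_conv_bdfDiff_sub_le {q : ℕ} (hq : q = 4 ∨ q = 5 ∨ q = 6)
    {K : ℝ≥0} {a b : ℝ} (hab : a < b) {v : ℝ → E} (h : HasBoundedNextDeriv q K (Set.Icc a b) v)
    {τ : ℝ} (hτ : 0 ≤ τ) {n : ℤ} (hn : a ≤ (n - q) * τ) (hn' : n * τ ≤ b) :
    ‖conv (bdfDiff q) (fun k : ℤ => v (k * τ)) n - τ • derivWithin v (Set.Icc a b) (n * τ)‖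
      ≤ (coeffNorm (bdfDiff q) + 1) * (K * (q * τ) ^ (q + 1)) := by
  have hq1 : (1 : ℝ) ≤ q := by rcases hq with rfl | rfl | rfl <;> norm_num
  have hqτ : 0 ≤ (q : ℝ) * τ := by positivity
  have hnn : (n : ℝ) * τ - (n - q) * τ = q * τ := by ring
  obtain ⟨w, hw⟩ := h.exists_taylor (convex_Icc a b) (uniqueDiffOn_Icc hab) (t := (n - q) * τ)
    ⟨hn, by linarith⟩
  set t := ((n : ℝ) - q) * τ with ht
  set y : ℤ → E := fun k : ℤ => v (k * τ)
  set z : ℤ → E := fun k : ℤ => ∑ i ∈ Finset.range (q + 1), (k * τ - t) ^ i • w i with hz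
  have h1 : ‖conv (bdfDiff q) (y - z) n‖ ≤ coeffNorm (bdfDiff q) * (K * (q * τ) ^ (q + 1)) := by
    refine norm_conv_le (natDegree_bdfDiff_le q) fun k hk hk' => ?_
    have hk1 : ((n : ℝ) - q) * τ ≤ k * τ :=
      mul_le_mul_of_nonneg_right (by exact_mod_cast hk) hτ
    have hk2 : (k : ℝ) * τ ≤ n * τ := mul_le_mul_of_nonneg_right (by exact_mod_cast hk') hτ
    refine ((hw (k * τ) ⟨hn.trans hk1, hk2.trans hn'⟩ hk1).1).trans ?_
    have : (k : ℝ) * τ - t ≤ q * τ := by linarith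
    have : 0 ≤ (k : ℝ) * τ - t := by linarith
    gcongr
  have h2 := (hw (n * τ) ⟨hn.trans (by linarith), hn'⟩ (by linarith)).2 (by exact_mod_cast hq1)
  rw [hnn] at h2
  have hsmul : ∀ (c : ℤ → ℝ) (x : E),
      conv (bdfDiff q) (fun k => c k • x) n = conv (bdfDiff q) c n • x := fun c x =>
    conv_map (bdfDiff q) (LinearMap.toSpanSingleton ℝ E x) c n
  have h3 : conv (bdfDiff q) z n
      = τ • ∑ i ∈ Finset.range q, (((i : ℝ) + 1) * (q * τ) ^ i) • w (i + 1) := by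
    have e : z = ∑ i ∈ Finset.range (q + 1), fun k : ℤ => (k * τ - t) ^ i • w i := by
      funext k
      simp [hz]
    have e' : conv (bdfDiff q) z n
        = ∑ i ∈ Finset.range (q + 1), conv (bdfDiff q) (fun k : ℤ => (k * τ - t) ^ i • w i) n := by
      rw [e]
      simp [conv, map_sum, Finset.sum_apply]
    rw [e', Finset.sum_range_succ', Finset.smul_sum]
    -- Constants are annihilated because every term of `bdfDiff` contains a factor `1 - X`.
    have h0 : conv (bdfDiff q) (fun k : ℤ => (k * τ - t) ^ 0 • w 0) n = 0 := by
      rw [conv_bdfDiff]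
      refine Finset.sum_eq_zero fun j hj => ?_
      obtain ⟨j, rfl⟩ := Nat.exists_eq_succ_of_ne_zero (by have := Finset.mem_Icc.1 hj; omega : j ≠ 0)
      rw [Nat.succ_eq_add_one, pow_succ, conv_mul]
      have : conv (1 - X) (fun k : ℤ => (k * τ - t) ^ 0 • w 0) = 0 := by
        funext k
        simp [conv, backShift_apply]
      rw [this]
      simp [conv]
    rw [h0, add_zero]
    refine Finset.sum_congr rfl fun i hi => ?_
    rw [hsmul, conv_bdfDiff_pow hq (Finset.mem_range.1 hi), smul_smul]
  have h4 : conv (bdfDiff q) y n - τ • derivWithin v (Set.Icc a b) (n * τ)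
      = conv (bdfDiff q) (y - z) n - τ • (derivWithin v (Set.Icc a b) (n * τ)
        - ∑ i ∈ Finset.range q, (((i : ℝ) + 1) * (q * τ) ^ i) • w (i + 1)) := by
    rw [conv_sub, Pi.sub_apply, h3, smul_sub]
    abel
  rw [h4, add_mul, one_mul]
  refine (norm_sub_le _ _).trans (add_le_add h1 ?_)
  rw [norm_smul, Real.norm_eq_abs, abs_of_nonneg hτ]
  calc τ * _ ≤ (q * τ) * (K * (q * τ) ^ q) :=
        mul_le_mul (by nlinarith) h2 (norm_nonneg _) hqτ
    _ = _ := by ring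

end Consistency

/-! ### The operator `M` and the coupling bound. -/

namespace EllipticParabolicSystem

variable {V W H : Type*}
  [NormedAddCommGroup V] [InnerProductSpace ℝ V] [CompleteSpace V]
  [NormedAddCommGroup W] [InnerProductSpace ℝ W] [CompleteSpace W]
  [NormedAddCommGroup H] [InnerProductSpace ℝ H] [CompleteSpace H]
  (S : EllipticParabolicSystem V W H)

theorem Ainv_add (l l' : V →L[ℝ] ℝ) : S.Ainv (l + l') = S.Ainv l + S.Ainv l' := by
  simp [Ainv]

theorem Ainv_smul (r : ℝ) (l : V →L[ℝ] ℝ) : S.Ainv (r • l) = r • S.Ainv l := by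
  simp [Ainv]

theorem norm_Ainv_le (l : V →L[ℝ] ℝ) : ‖S.Ainv l‖ ≤ S.ca⁻¹ * ‖l‖ := by
  have h1 := S.a_coercive (S.Ainv l)
  rw [S.a_Ainv] at h1
  have h2 := (le_abs_self _).trans (l.le_opNorm (S.Ainv l))
  rw [inv_mul_eq_div, le_div_iff₀ S.ca_pos]
  rcases (norm_nonneg (S.Ainv l)).eq_or_lt with h0 | h0
  · rw [← h0, zero_mul]
    exact norm_nonneg _
  · refine le_of_mul_le_mul_right ?_ h0
    linarith

/-- The operator `D A⁻¹ : V' → H'` as a continuous linear map. -/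
noncomputable def DAinvCLM : (V →L[ℝ] ℝ) →L[ℝ] (H →L[ℝ] ℝ) :=
  S.d ∘L LinearMap.mkContinuous
    { toFun := S.Ainv
      map_add' := S.Ainv_add
      map_smul' := S.Ainv_smul } S.ca⁻¹ S.norm_Ainv_le

theorem DAinvCLM_apply (l : V →L[ℝ] ℝ) : S.DAinvCLM l = S.DAinv l := rfl

/-- The operator `M` as a continuous linear map. -/
noncomputable def MCLM : H →L[ℝ] (H →L[ℝ] ℝ) := S.DAinvCLM ∘L S.d.flip

theorem MCLM_apply (x : H) : S.MCLM x = S.M x := rfl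

/-- Expressing `M` through `a` makes its symmetry and nonnegativity those of `a`. -/
theorem M_apply (x y : H) : S.M x y = S.a (S.Ainv (S.d.flip y)) (S.Ainv (S.d.flip x)) := by
  rw [S.a_Ainv]
  rfl

theorem M_symm (x y : H) : S.M x y = S.M y x := by
  rw [M_apply, M_apply, S.a_symm]

theorem M_nonneg (x : H) : 0 ≤ S.M x x := by
  rw [M_apply]
  exact (mul_nonneg S.ca_pos.le (sq_nonneg _)).trans (S.a_coercive _)

/-- With `u = A⁻¹ D⋆ x`, one has `c_a ‖u‖² ≤ M(x, x) ≤ C_d ‖u‖ ‖x‖`. Eliminating `‖u‖` gives `c_a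
M(x, x) ≤ C_d² ‖x‖²`, and coercivity of `c` finishes. -/
theorem M_le (x : H) : S.M x x ≤ S.couplingStrength * S.c x x := by
  have h1 := S.a_coercive (S.Ainv (S.d.flip x))
  rw [← M_apply] at h1
  have h2 : S.M x x ≤ S.Cd * ‖S.Ainv (S.d.flip x)‖ * ‖x‖ := S.d_le _ _
  have h3 := S.c_coercive x
  have hca := S.ca_pos
  have hcc := S.cc_pos
  have h4 : S.ca * S.M x x ≤ S.Cd ^ 2 * ‖x‖ ^ 2 := by
    nlinarith [sq_nonneg (S.ca * ‖S.Ainv (S.d.flip x)‖ - S.Cd * ‖x‖),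
      mul_le_mul_of_nonneg_left h2 hca.le, mul_le_mul_of_nonneg_left h1 hca.le]
  rw [couplingStrength, div_mul_eq_mul_div, le_div_iff₀ (by positivity)]
  nlinarith [mul_le_mul_of_nonneg_left h4 hcc.le, mul_le_mul_of_nonneg_left h3 (sq_nonneg S.Cd)]

end EllipticParabolicSystem

/-- The bilinear form of a continuous bilinear map. -/
noncomputable def bilinOf {E : Type*} [NormedAddCommGroup E] [NormedSpace ℝ E] (f : E →L[ℝ] E →L[ℝ] ℝ) :
    LinearMap.BilinForm ℝ E :=
  LinearMap.mk₂ ℝ (fun x y => f x y) (by simp) (by simp) (by simp) (by simp)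

theorem bilinOf_apply {E : Type*} [NormedAddCommGroup E] [NormedSpace ℝ E]
    (f : E →L[ℝ] E →L[ℝ] ℝ) (x y : E) : bilinOf f x y = f x y := rfl

/-! ### Stability by the multiplier method. -/

namespace EllipticParabolicSystem

variable {V W H : Type*}
  [NormedAddCommGroup V] [InnerProductSpace ℝ V] [CompleteSpace V]
  [NormedAddCommGroup W] [InnerProductSpace ℝ W] [CompleteSpace W]
  [NormedAddCommGroup H] [InnerProductSpace ℝ H] [CompleteSpace H]
  (S : EllipticParabolicSystem V W H)

/-- The discrete operator `C α(S) x + M (α γ)(S) x` of the scheme, with values in `H'`. -/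
noncomputable def discreteOp (q : ℕ) (x : ℤ → H) (n : ℤ) : H →L[ℝ] ℝ :=
  S.c (conv (bdfDiff q) x n) + S.M (conv (bdfDiff q * bdfExtrap q) x n)

theorem discreteOp_add (q : ℕ) (x z : ℤ → H) (n : ℤ) :
    S.discreteOp q (x + z) n = S.discreteOp q x n + S.discreteOp q z n := by
  simp only [discreteOp, conv_add, Pi.add_apply, map_add, ← MCLM_apply]
  abel

/-- The convolution of the scheme with a multiplier, tested with an element of `W`. -/
theorem conv_discreteOp {q : ℕ} {τ : ℝ} {m : ℤ} {y : ℤ → W} {r : ℤ → H →L[ℝ] ℝ}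
    (heq : ∀ n ≤ m, ∀ w, S.discreteOp q (fun k => S.emb (y k)) n (S.emb w) + τ * S.b (y n) w
      = r n (S.emb w)) (ν : ℝ[X]) {n : ℤ} (hn : n ≤ m) (w : W) :
    S.c (conv (ν * bdfDiff q) (fun k => S.emb (y k)) n) (S.emb w)
      + S.M (conv (ν * (bdfDiff q * bdfExtrap q)) (fun k => S.emb (y k)) n) (S.emb w)
      + τ * S.b (conv ν y n) w = conv ν r n (S.emb w) := by
  set x : ℤ → H := fun k => S.emb (y k)
  -- The equation is needed at every index up to `m`, negative ones included, because convolution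
  -- with `ν` reaches backwards.
  have h := conv_congr (κ := ν) le_rfl
    (y := (fun k => S.c (conv (bdfDiff q) x k) (S.emb w))
      + (fun k => S.MCLM (conv (bdfDiff q * bdfExtrap q) x k) (S.emb w))
      + τ • (fun k => S.b (y k) w)) (z := fun k => r k (S.emb w)) (n := n)
    (fun k _ hk => heq k (hk.trans hn) w)
  rw [conv_add, conv_add, conv_smul] at h
  have h1 := conv_map ν (S.c.flip (S.emb w) : H →ₗ[ℝ] ℝ) (conv (bdfDiff q) x) n
  have h2 := conv_map ν (S.MCLM.flip (S.emb w) : H →ₗ[ℝ] ℝ)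
    (conv (bdfDiff q * bdfExtrap q) x) n
  have h3 := conv_map ν (S.b.flip w : W →ₗ[ℝ] ℝ) y n
  have h4 := conv_map ν (ContinuousLinearMap.apply ℝ ℝ (S.emb w) : (H →L[ℝ] ℝ) →ₗ[ℝ] ℝ) r n
  simp only [ContinuousLinearMap.coe_coe, ContinuousLinearMap.flip_apply,
    ContinuousLinearMap.apply_apply] at h1 h2 h3 h4
  simp only [Pi.add_apply, Pi.smul_apply, smul_eq_mul, h1, h2, h3, h4] at h
  rw [conv_mul, conv_mul, ← MCLM_apply]
  exact h

/-- The energy estimate for zero starting values. -/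
theorem energy_estimate {q : ℕ} (hq : q = 4 ∨ q = 5 ∨ q = 6)
    (hω : S.couplingStrength ≤ 1 / (2 ^ q - 1)) :
    ∃ C : ℝ, 0 < C ∧ ∀ (τ : ℝ) (m : ℕ) (y : ℤ → W) (r : ℤ → H →L[ℝ] ℝ) (B : ℝ), 0 ≤ τ →
      (∀ k < 0, y k = 0) → (∀ k < 0, r k = 0) →
      (∀ n ≤ (m : ℤ), ∀ w, S.discreteOp q (fun k => S.emb (y k)) n (S.emb w) + τ * S.b (y n) w
        = r n (S.emb w)) →
      (∀ n : ℕ, n ≤ m → ‖S.emb (y n)‖ ≤ B) →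
      ‖S.emb (y m)‖ ^ 2 ≤ C * B * ∑ n ∈ Finset.range (m + 1), ‖r n‖ := by
  obtain ⟨ν, c, hc, hν⟩ := exists_multiplier hq
  have hcc := S.cc_pos
  have hC : 0 ≤ 4 / (c * S.cc) * coeffNorm ν := by
    have := coeffNorm_nonneg ν
    positivity
  -- The added `1` only makes the constant strictly positive.
  refine ⟨4 / (c * S.cc) * coeffNorm ν + 1, by linarith, ?_⟩
  intro τ m y r B hτ hy hr heq hB
  set x : ℤ → H := fun k => S.emb (y k) with hx
  have hx0 : ∀ k < 0, x k = 0 := fun k hk => by simp [hx, hy k hk]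
  have hq2 : (0 : ℝ) < 2 ^ q - 1 := by rcases hq with rfl | rfl | rfl <;> norm_num
  set μ : ℝ := 2 ^ q - 1 with hμ
  have hB0 : 0 ≤ B := (norm_nonneg _).trans (hB m le_rfl)
  have hcpos : ∀ u : H, 0 ≤ S.c u u := fun u =>
    (mul_nonneg hcc.le (sq_nonneg _)).trans (S.c_coercive u)
  have hMc : ∀ u : H, μ * S.M u u ≤ S.c u u := fun u => by
    have h1 := (S.M_le u).trans (mul_le_mul_of_nonneg_right hω (hcpos u))
    rw [one_div_mul_eq_div, le_div_iff₀ hq2] at h1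
    linarith
  -- `C - μM` is paired with the symbol `νA` and `μM` with `νA(1 + G/μ)`. The two lower bounds add
  -- up to one in terms of `C` alone, so coercivity of `c` applies.
  have hT₁ := toeplitz_coercive hc.le (fun θ => (hν θ).2.1) (P := bilinOf (S.c - μ • S.MCLM))
    (fun u v => by
      simp only [bilinOf_apply, sub_apply, smul_apply,
        MCLM_apply, S.c_symm u v, S.M_symm u v])
    (fun u => by
      simp only [bilinOf_apply, sub_apply, smul_apply,
        MCLM_apply, smul_eq_mul]
      linarith [hMc u]) hx0 m
  have hT₂ := toeplitz_coercive hc.le (fun θ => (hν θ).2.2) (P := bilinOf (μ • S.MCLM))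
    (fun u v => by
      simp only [bilinOf_apply, smul_apply, MCLM_apply, S.M_symm u v])
    (fun u => by
      simp only [bilinOf_apply, smul_apply, MCLM_apply, smul_eq_mul]
      exact mul_nonneg hq2.le (S.M_nonneg u)) hx0 m
  have hT₃ := toeplitz_nonneg (fun θ => (hν θ).1) (P := bilinOf S.b) S.b_symm
    (fun w => (mul_nonneg S.cb_pos.le (sq_nonneg _)).trans (S.b_coercive w)) hy (m + 1)
  have hκ : ∀ n, conv (ν * bdfDiff q * (1 + C (1 / μ) * bdfExtrap q)) x n
      = conv (ν * bdfDiff q) x n + (1 / μ) • conv (ν * (bdfDiff q * bdfExtrap q)) x n := by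
    intro n
    rw [show ν * bdfDiff q * (1 + C (1 / μ) * bdfExtrap q)
      = ν * bdfDiff q + C (1 / μ) * (ν * (bdfDiff q * bdfExtrap q)) by ring, conv_add_left,
      conv_smul_left]
    rfl
  have hsum : ∑ n ∈ Finset.range (m + 1), bilinOf (S.c - μ • S.MCLM)
          (conv (ν * bdfDiff q) x n) (x n)
      + ∑ n ∈ Finset.range (m + 1), bilinOf (μ • S.MCLM)
          (conv (ν * bdfDiff q * (1 + C (1 / μ) * bdfExtrap q)) x n) (x n)
      + τ * ∑ n ∈ Finset.range (m + 1), bilinOf S.b (conv ν y n) (y n)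
      = ∑ n ∈ Finset.range (m + 1), conv ν r n (x n) := by
    rw [Finset.mul_sum, ← Finset.sum_add_distrib, ← Finset.sum_add_distrib]
    refine Finset.sum_congr rfl fun n hn => ?_
    have h := S.conv_discreteOp heq ν (n := n) (by have := Finset.mem_range.1 hn; omega) (y n)
    rw [← hx] at h
    change _ = conv ν r n (S.emb (y n))
    rw [hκ, ← h, map_add, map_smul, LinearMap.add_apply, LinearMap.smul_apply,
      show x n = S.emb (y n) from rfl]
    simp only [bilinOf_apply, sub_apply, smul_apply, ← MCLM_apply, smul_eq_mul]
    field_simp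
    ring
  have hlow : c / 4 * (S.cc * ‖x m‖ ^ 2) ≤ ∑ n ∈ Finset.range (m + 1), conv ν r n (x n) := by
    rw [← hsum]
    have h1 := mul_le_mul_of_nonneg_left (S.c_coercive (x m)) (by positivity : 0 ≤ c / 4)
    have h2 := mul_nonneg hτ hT₃
    simp only [bilinOf_apply, sub_apply, smul_apply,
      smul_eq_mul] at hT₁ hT₂ h2 ⊢
    linarith
  have hup : ∑ n ∈ Finset.range (m + 1), conv ν r n (x n)
      ≤ coeffNorm ν * (∑ n ∈ Finset.range (m + 1), ‖r n‖) * B := by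
    refine le_trans ?_ (mul_le_mul_of_nonneg_right (sum_norm_conv_le ν hr m) hB0)
    rw [Finset.sum_mul]
    refine Finset.sum_le_sum fun n hn => ?_
    refine (le_abs_self _).trans (((conv ν r n).le_opNorm (x n)).trans ?_)
    exact mul_le_mul_of_nonneg_left (hB n (by have := Finset.mem_range.1 hn; omega))
      (norm_nonneg _)
  have hR : 0 ≤ ∑ n ∈ Finset.range (m + 1), ‖r n‖ := Finset.sum_nonneg fun _ _ => norm_nonneg _
  have hfin : ‖x m‖ ^ 2 ≤ 4 / (c * S.cc) * coeffNorm ν * B * ∑ n ∈ Finset.range (m + 1), ‖r n‖ := by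
    have h := hlow.trans hup
    calc ‖x m‖ ^ 2 = 4 / (c * S.cc) * (c / 4 * (S.cc * ‖x m‖ ^ 2)) := by field_simp
      _ ≤ 4 / (c * S.cc) * _ := mul_le_mul_of_nonneg_left h (by positivity)
      _ = _ := by ring
  refine hfin.trans ?_
  have := mul_nonneg hB0 hR
  nlinarith

/-- Stability of the scheme for zero starting values. -/
theorem stability_zero_start {q : ℕ} (hq : q = 4 ∨ q = 5 ∨ q = 6)
    (hω : S.couplingStrength ≤ 1 / (2 ^ q - 1)) :
    ∃ C : ℝ, 0 < C ∧ ∀ (τ : ℝ) (N : ℕ) (y : ℤ → W) (r : ℤ → H →L[ℝ] ℝ), 0 ≤ τ →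
      (∀ k < 0, y k = 0) → (∀ k < 0, r k = 0) →
      (∀ n ≤ (N : ℤ), ∀ w, S.discreteOp q (fun k => S.emb (y k)) n (S.emb w) + τ * S.b (y n) w
        = r n (S.emb w)) →
      ∀ n : ℕ, n ≤ N → ‖S.emb (y n)‖ ≤ C * ∑ n ∈ Finset.range (N + 1), ‖r n‖ := by
  obtain ⟨C, hC, h⟩ := S.energy_estimate hq hω
  refine ⟨C, hC, fun τ N y r hτ hy hr heq n hn => ?_⟩
  -- At the maximizing index the energy estimate holds with `B = ‖y_m‖`, and one factor `‖y_m‖`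
  -- cancels.
  obtain ⟨m, hm, hmax⟩ := Finset.exists_max_image (Finset.range (N + 1))
    (fun n : ℕ => ‖S.emb (y n)‖) ⟨0, by simp⟩
  have hmN : m ≤ N := by have := Finset.mem_range.1 hm; omega
  refine (hmax n (by simp; omega)).trans ?_
  have h1 := h τ m y r ‖S.emb (y m)‖ hτ hy hr (fun n hn => heq n (hn.trans (by exact_mod_cast hmN)))
    (fun n hn => hmax n (by simp; omega))
  have h2 : ∑ n ∈ Finset.range (m + 1), ‖r n‖ ≤ ∑ n ∈ Finset.range (N + 1), ‖r n‖ :=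
    Finset.sum_le_sum_of_subset_of_nonneg (Finset.range_mono (by omega)) fun _ _ _ => norm_nonneg _
  refine le_trans ?_ (mul_le_mul_of_nonneg_left h2 hC.le)
  rcases (norm_nonneg (S.emb (y m))).eq_or_lt with h0 | h0
  · rw [← h0]
    exact mul_nonneg hC.le (Finset.sum_nonneg fun _ _ => norm_nonneg _)
  · refine le_of_mul_le_mul_right ?_ h0
    linarith

/-- Stability of the scheme. -/
theorem stability {q : ℕ} (hq : q = 4 ∨ q = 5 ∨ q = 6)
    (hω : S.couplingStrength ≤ 1 / (2 ^ q - 1)) :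
    ∃ C : ℝ, 0 < C ∧ ∀ (τ : ℝ) (N : ℕ) (e : ℤ → W) (ρ : ℤ → H →L[ℝ] ℝ) (B : ℝ), 0 ≤ τ →
      (∀ k : ℤ, -q ≤ k → k < 0 → e k = 0) →
      (∀ n : ℤ, q ≤ n → n ≤ N → ∀ w,
        S.discreteOp q (fun k => S.emb (e k)) n (S.emb w) + τ * S.b (e n) w = ρ n (S.emb w)) →
      (∀ n : ℤ, q ≤ n → n ≤ N → ‖ρ n‖ ≤ B) → 0 ≤ B →
      ∀ n : ℕ, q ≤ n → n ≤ N →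
        ‖S.emb (e n)‖ ≤ C * ((N + 1) * B + ∑ j ∈ Finset.range q, ‖S.emb (e j)‖) := by
  obtain ⟨C, hC, h⟩ := S.stability_zero_start hq hω
  set L : ℝ := ‖S.c‖ * coeffNorm (bdfDiff q) + ‖S.MCLM‖ * coeffNorm (bdfDiff q * bdfExtrap q)
    with hL
  have hL0 : 0 ≤ L := by
    have := coeffNorm_nonneg (bdfDiff q)
    have := coeffNorm_nonneg (bdfDiff q * bdfExtrap q)
    positivity
  refine ⟨C * (1 + 3 * q * L), by positivity, ?_⟩
  intro τ N e ρ B hτ he heq hρ hB n hn hnN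
  -- The error is split into its part `y` from index `q` on, which has zero start, and the starting
  -- part `z`. For `n ≥ q` the term `B e^n` does not see `z`, so starting errors enter only through
  -- their `H` norms.
  set y : ℤ → W := fun k => if q ≤ k then e k else 0 with hy
  set z : ℤ → W := fun k => if 0 ≤ k ∧ k < q then e k else 0 with hz
  set σ := ∑ j ∈ Finset.range q, ‖S.emb (e j)‖ with hσ
  have hσ0 : 0 ≤ σ := Finset.sum_nonneg fun _ _ => norm_nonneg _
  have hzn : ∀ k, ‖S.emb (z k)‖ ≤ σ := by
    intro k
    simp only [hz]
    split_ifs with hk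
    · lift k to ℕ using hk.1
      exact Finset.single_le_sum (f := fun j : ℕ => ‖S.emb (e j)‖) (fun _ _ => norm_nonneg _)
        (Finset.mem_range.2 (by omega))
    · simpa using hσ0
  have hdA := natDegree_bdfDiff_le q
  have hdAG : (bdfDiff q * bdfExtrap q).natDegree ≤ 2 * q := by
    have h1 := natDegree_mul_le (p := bdfDiff q) (q := bdfExtrap q)
    have h2 := natDegree_bdfExtrap_le q
    omega
  set Z : ℤ → H →L[ℝ] ℝ := fun n => S.discreteOp q (fun k => S.emb (z k)) n with hZ
  have hZn : ∀ n, ‖Z n‖ ≤ L * σ := by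
    intro n
    simp only [hZ, discreteOp, ← MCLM_apply]
    refine (norm_add_le _ _).trans ?_
    rw [hL, add_mul, mul_assoc, mul_assoc]
    exact add_le_add
      ((S.c.le_opNorm _).trans (mul_le_mul_of_nonneg_left
        (norm_conv_le le_rfl fun k _ _ => hzn k) (norm_nonneg _)))
      ((S.MCLM.le_opNorm _).trans (mul_le_mul_of_nonneg_left
        (norm_conv_le le_rfl fun k _ _ => hzn k) (norm_nonneg _)))
  -- `z` lives on indices below `q` and the operator looks back at most `2q` steps, so the
  -- perturbation dies out from index `3q` on.
  have hZ0 : ∀ n : ℤ, 3 * q ≤ n → Z n = 0 := by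
    intro n hn
    have hz0 : ∀ k : ℤ, q ≤ k → S.emb (z k) = 0 := fun k hk => by
      simp only [hz]
      rw [if_neg (by omega), map_zero]
    simp only [hZ, discreteOp, ← MCLM_apply]
    rw [conv_eq_zero hdA fun k hk _ => hz0 k (by omega),
      conv_eq_zero hdAG fun k hk _ => hz0 k (by push_cast at hk; omega)]
    simp
  set r : ℤ → H →L[ℝ] ℝ := fun n => if q ≤ n then ρ n - Z n else 0 with hr
  have hmain := h τ N y r hτ (fun k hk => by simp only [hy]; rw [if_neg (by omega)])
    (fun k hk => by simp only [hr]; rw [if_neg (by omega)]) ?_ n hnN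
  · simp only [hy] at hmain
    rw [if_pos (by exact_mod_cast hn)] at hmain
    refine hmain.trans ?_
    rw [mul_assoc]
    refine mul_le_mul_of_nonneg_left ?_ hC.le
    have hterm : ∀ n ∈ Finset.range (N + 1), ‖r n‖ ≤ B + (if n < 3 * q then L * σ else 0) := by
      intro n hn
      have hn' := Finset.mem_range.1 hn
      simp only [hr]
      by_cases h1 : (q : ℤ) ≤ n
      · rw [if_pos h1]
        refine (norm_sub_le _ _).trans (add_le_add (hρ n h1 (by omega)) ?_)
        split_ifs with h2
        · exact hZn n
        · rw [hZ0 n (by omega), norm_zero]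
      · rw [if_neg h1, norm_zero]
        split_ifs <;> positivity
    refine (Finset.sum_le_sum hterm).trans ?_
    have hcard : ∑ n ∈ Finset.range (N + 1), (if n < 3 * q then L * σ else 0)
        ≤ 3 * q * (L * σ) := by
      rw [← Finset.sum_filter, Finset.sum_const, nsmul_eq_mul]
      refine mul_le_mul_of_nonneg_right ?_ (by positivity)
      have : ((Finset.range (N + 1)).filter (fun n => n < 3 * q)).card ≤ (Finset.range (3 * q)).card :=
        Finset.card_le_card fun k hk => by
          simp only [Finset.mem_filter, Finset.mem_range] at hk ⊢
          exact hk.2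
      rw [Finset.card_range] at this
      exact_mod_cast this
    rw [Finset.sum_add_distrib, Finset.sum_const, Finset.card_range, nsmul_eq_mul]
    push_cast
    have h5 : 0 ≤ 3 * q * L * ((N + 1) * B) := by positivity
    nlinarith
  · intro n hnN w
    simp only [hr, hy]
    by_cases hqn : (q : ℤ) ≤ n
    · rw [if_pos hqn, if_pos hqn]
      have hsplit : S.discreteOp q (fun k => S.emb (e k)) n
          = S.discreteOp q (fun k => S.emb (y k)) n + Z n := by
        rw [hZ, ← discreteOp_add]
        -- For `n ≥ q` the operator looks back no further than `n - 2q ≥ -q`, which is where the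
        -- vanishing history is used.
        have hyz : ∀ k : ℤ, -q ≤ k → S.emb (e k) = S.emb (y k) + S.emb (z k) := by
          intro k hk
          rw [← map_add]
          congr 1
          simp only [hy, hz]
          rcases lt_or_ge k 0 with h0 | h0
          · rw [if_neg (by omega), if_neg (by omega), he k hk h0, add_zero]
          · rcases lt_or_ge k q with h1 | h1
            · rw [if_neg (by omega), if_pos ⟨h0, h1⟩, zero_add]
            · rw [if_pos h1, if_neg (by omega), add_zero]
        rw [discreteOp, discreteOp]
        congr 2
        · exact conv_congr hdA fun k hk _ => hyz k (by omega)
        · exact conv_congr hdAG fun k hk _ => hyz k (by push_cast at hk; omega)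
      have h1 := heq n hqn hnN w
      rw [hsplit] at h1
      simp only [add_apply, sub_apply] at h1 ⊢
      linarith
    -- Below index `q` both sides vanish by causality.
    · rw [if_neg hqn, if_neg hqn]
      have hy0 : ∀ k ≤ n, S.emb (if (q : ℤ) ≤ k then e k else 0) = 0 := fun k hk => by
        rw [if_neg (by omega), map_zero]
      rw [discreteOp, conv_eq_zero hdA fun k _ hk => hy0 k hk,
        conv_eq_zero hdAG fun k _ hk => hy0 k hk, ← MCLM_apply]
      simp

end EllipticParabolicSystem

/-! ### Consistency error and error equation. -/

namespace EllipticParabolicSystem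

variable {V W H : Type*}
  [NormedAddCommGroup V] [InnerProductSpace ℝ V] [CompleteSpace V]
  [NormedAddCommGroup W] [InnerProductSpace ℝ W] [CompleteSpace W]
  [NormedAddCommGroup H] [InnerProductSpace ℝ H] [CompleteSpace H]
  (S : EllipticParabolicSystem V W H)

/-- The consistency error of the scheme at the `n`-th node, as a functional on `H`. -/
noncomputable def consistencyError (q : ℕ) (τ T : ℝ) (f : ℝ → V →L[ℝ] ℝ) (𝔭 : ℝ → W) (n : ℤ) :
    H →L[ℝ] ℝ :=
  let u : ℝ → H := fun s => S.emb (𝔭 s)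
  let δ : ℤ → H := fun k => conv (bdfDiff q) (fun k : ℤ => u (k * τ)) k
    - τ • derivWithin u (Set.Icc (-(q * τ)) T) (k * τ)
  S.c (δ n) + S.MCLM (conv (bdfExtrap q) δ n)
    + S.DAinvCLM (conv (bdfDiff q) (fun k : ℤ => f (k * τ)) n
      - τ • derivWithin f (Set.Icc 0 T) (n * τ))

theorem norm_consistencyError_le {q : ℕ} (hq : q = 4 ∨ q = 5 ∨ q = 6) {τ T : ℝ} (hτ : 0 ≤ τ)
    (hT : 0 < T) {K : ℝ≥0} {f : ℝ → V →L[ℝ] ℝ} {𝔭 : ℝ → W}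
    (hf : HasBoundedNextDeriv q K (Set.Icc 0 T) f)
    (hp : HasBoundedNextDeriv q K (Set.Icc (-(q * τ)) T) (fun s => S.emb (𝔭 s)))
    {n : ℤ} (hn : q ≤ n) (hnT : n * τ ≤ T) :
    ‖S.consistencyError q τ T f 𝔭 n‖
      ≤ (‖S.c‖ + ‖S.MCLM‖ * coeffNorm (bdfExtrap q) + ‖S.DAinvCLM‖)
        * ((coeffNorm (bdfDiff q) + 1) * (K * (q * τ) ^ (q + 1))) := by
  set D := (coeffNorm (bdfDiff q) + 1) * (K * (q * τ) ^ (q + 1)) with hD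
  have hab : -(q * τ) < T := by
    have : 0 ≤ (q : ℝ) * τ := by positivity
    linarith
  -- The extrapolation evaluates the BDF defect at nodes `k ≥ n - q ≥ 0`, whose stencils reach down
  -- to `k - q ≥ -q`: exactly the history interval.
  have hδ : ∀ k : ℤ, 0 ≤ k → k ≤ n →
      ‖conv (bdfDiff q) (fun k : ℤ => S.emb (𝔭 (k * τ))) k
        - τ • derivWithin (fun s => S.emb (𝔭 s)) (Set.Icc (-(q * τ)) T) (k * τ)‖ ≤ D := by
    intro k hk0 hkn
    have h0 : (0 : ℝ) ≤ k := by exact_mod_cast hk0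
    have h1 : (k : ℝ) * τ ≤ n * τ := mul_le_mul_of_nonneg_right (by exact_mod_cast hkn) hτ
    exact hp.norm_conv_bdfDiff_sub_le hq hab hτ (by nlinarith) (h1.trans hnT)
  have hφ := hf.norm_conv_bdfDiff_sub_le hq hT hτ (n := n)
    (mul_nonneg (sub_nonneg.2 (by exact_mod_cast hn)) hτ) hnT
  simp only [consistencyError]
  refine (norm_add₃_le).trans ?_
  rw [add_mul, add_mul, mul_assoc]
  refine add_le_add (add_le_add ?_ ?_) ?_
  · exact (S.c.le_opNorm _).trans
      (mul_le_mul_of_nonneg_left (hδ n (by omega) le_rfl) (norm_nonneg _))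
  · exact (S.MCLM.le_opNorm _).trans (mul_le_mul_of_nonneg_left
      (norm_conv_le (natDegree_bdfExtrap_le q) fun k hk hk' => hδ k (by omega) hk')
      (norm_nonneg _))
  · exact (S.DAinvCLM.le_opNorm _).trans (mul_le_mul_of_nonneg_left hφ (norm_nonneg _))

/-- The error of the scheme satisfies the scheme up to the consistency error. -/
theorem error_equation {q N : ℕ} (hq : 1 ≤ q) {τ T : ℝ} (hτ : 0 < τ) (hNT : N * τ ≤ T)
    {f : ℝ → V →L[ℝ] ℝ} {g : ℝ → W →L[ℝ] ℝ} {𝔭 : ℝ → W} {p : ℤ → W}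
    (hsol : S.IsDelaySolution q τ T f g 𝔭) (hbdf : S.IsImexBDF q N τ f g p)
    {n : ℤ} (hn : q ≤ n) (hnN : n ≤ N) (w : W) :
    S.discreteOp q (fun k => S.emb (𝔭 (k * τ) - p k)) n (S.emb w)
      + τ * S.b (𝔭 (n * τ) - p n) w = S.consistencyError q τ T f 𝔭 n (S.emb w) := by
  lift n to ℕ using by omega
  have hn1 : q ≤ n := by exact_mod_cast hn
  have hnN1 : n ≤ N := by exact_mod_cast hnN
  have hn0 : (0 : ℝ) < n := by exact_mod_cast (by omega : 0 < n)
  have hmem : (n : ℝ) * τ ∈ Set.Ioc 0 T :=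
    ⟨by positivity, (mul_le_mul_of_nonneg_right (by exact_mod_cast hnN1) hτ.le).trans hNT⟩
  have h1 := hbdf.step n hn1 hnN1 w
  rw [sum_bdfAlphaTilde q (fun k => S.emb (p k)), sum_bdfAlphaHat hq (fun k => S.emb (p k))] at h1
  have hfs := sum_bdfAlphaTilde q (fun k : ℤ => f (k * τ)) n
  push_cast at hfs
  rw [hfs] at h1
  have h2 := hsol.eq (n * τ) hmem w
  set d : ℝ → H := derivWithin (fun s => S.emb (𝔭 s)) (Set.Icc (-(q * τ)) T)
  have hds := sum_bdfGamma hq (fun k : ℤ => d (k * τ)) n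
  have hds' : ∑ j ∈ Finset.range q, (bdfGamma q).coeff j • d (n * τ - q * τ + j * τ)
      = conv (bdfExtrap q) (fun k : ℤ => d (k * τ)) n := by
    rw [← hds]
    refine Finset.sum_congr rfl fun j _ => ?_
    push_cast
    congr 2
    ring
  rw [hds'] at h2
  have hsub : (fun k : ℤ => S.emb (𝔭 (k * τ) - p k))
      = (fun k : ℤ => S.emb (𝔭 (k * τ))) - fun k => S.emb (p k) := by
    funext k
    simp
  have hδ : (fun k : ℤ => conv (bdfDiff q) (fun k : ℤ => S.emb (𝔭 (k * τ))) k - τ • d (k * τ))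
      = conv (bdfDiff q) (fun k : ℤ => S.emb (𝔭 (k * τ))) - τ • fun k : ℤ => d (k * τ) := rfl
  simp only [consistencyError, discreteOp]
  -- The factors are commuted so that the extrapolation acts last, on BDF differences. Then `τ`
  -- times the delay equation minus the scheme gives the claim.
  rw [hδ, hsub, mul_comm (bdfDiff q), conv_mul, conv_sub, conv_sub, conv_sub, conv_smul]
  rw [mul_comm (bdfDiff q), conv_mul] at h1
  simp only [← MCLM_apply, ← DAinvCLM_apply, Pi.sub_apply, Pi.smul_apply, map_sub, map_smul,
    add_apply, sub_apply, smul_apply, smul_eq_mul, Int.cast_natCast] at h1 h2 ⊢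
  linear_combination τ * h2 - h1

end EllipticParabolicSystem

/-! ### The error estimate. -/

theorem theorem7p3 {V W H : Type*}
    [NormedAddCommGroup V] [InnerProductSpace ℝ V] [CompleteSpace V]
    [NormedAddCommGroup W] [InnerProductSpace ℝ W] [CompleteSpace W]
    [NormedAddCommGroup H] [InnerProductSpace ℝ H] [CompleteSpace H]
    (S : EllipticParabolicSystem V W H)
    (q : ℕ) (hq : q = 4 ∨ q = 5 ∨ q = 6)
    (hω : S.couplingStrength ≤ 1 / (2 ^ q - 1))
    (T : ℝ) (hT : 0 < T) (K : ℝ≥0) :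
    ∃ C : ℝ, 0 < C ∧
      ∀ (N : ℕ) (τ : ℝ), 0 < N → τ = T / N →
      ∀ (f : ℝ → V →L[ℝ] ℝ) (g : ℝ → W →L[ℝ] ℝ) (𝔭 : ℝ → W) (p : ℤ → W),
        HasBoundedNextDeriv q K (Set.Icc 0 T) f →
        HasBoundedNextDeriv q K (Set.Icc (-(q * τ)) T) (fun s => S.emb (𝔭 s)) →
        S.IsDelaySolution q τ T f g 𝔭 →
        S.IsImexBDF q N τ f g p →
        (∀ l : ℕ, l ≤ q → 𝔭 (-(l * τ)) = p (-(l : ℤ))) →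
        ∀ n : ℕ, q ≤ n → n ≤ N →
          ‖S.emb (𝔭 (n * τ) - p n)‖ ^ 2 ≤
            C * τ ^ (2 * q)
              + C * ∑ j ∈ Finset.range q,
                  (‖S.emb (𝔭 (j * τ) - p j)‖ ^ 2 + τ * ‖𝔭 (j * τ) - p j‖ ^ 2) := by

  have hq1 : 1 ≤ q := by omega
  obtain ⟨C, hC, hstab⟩ := S.stability hq hω
  set D : ℝ := (‖S.c‖ + ‖S.MCLM‖ * coeffNorm (bdfExtrap q) + ‖S.DAinvCLM‖)
    * ((coeffNorm (bdfDiff q) + 1) * (K * (q : ℝ) ^ (q + 1))) with hD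
  have hD0 : 0 ≤ D := by
    have := coeffNorm_nonneg (bdfExtrap q)
    have := coeffNorm_nonneg (bdfDiff q)
    positivity
  refine ⟨2 * C ^ 2 * ((2 * T * D) ^ 2 + q), by positivity, ?_⟩
  intro N τ hN hτN f g 𝔭 p hf hp hsol hbdf hhist n hqn hnN
  have hN0 : (0 : ℝ) < N := by exact_mod_cast hN
  have hτ : 0 < τ := by rw [hτN]; positivity
  have hNT : N * τ = T := by rw [hτN]; field_simp
  have hbound : ∀ n : ℤ, q ≤ n → n ≤ N →
      ‖S.consistencyError q τ T f 𝔭 n‖ ≤ D * τ ^ (q + 1) := by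
    intro n hn hnN
    have hnT : (n : ℝ) * τ ≤ T := by
      rw [← hNT]
      exact mul_le_mul_of_nonneg_right (by exact_mod_cast hnN) hτ.le
    refine (S.norm_consistencyError_le hq hτ.le hT hf hp hn hnT).trans (le_of_eq ?_)
    rw [hD, mul_pow]
    ring
  have herr := hstab τ N (fun k => 𝔭 (k * τ) - p k) (S.consistencyError q τ T f 𝔭)
    (D * τ ^ (q + 1)) hτ.le
    (fun k hk hk0 => by
      obtain ⟨l, rfl⟩ : ∃ l : ℕ, k = -(l : ℤ) := ⟨k.natAbs, by omega⟩
      have := hhist l (by omega)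
      push_cast
      rw [neg_mul, this, sub_self])
    (fun n hn hnN w => S.error_equation hq1 hτ hNT.le hsol hbdf hn hnN w)
    hbound (by positivity) n hqn hnN
  simp only [Int.cast_natCast] at herr
  set σ := ∑ j ∈ Finset.range q, ‖S.emb (𝔭 (j * τ) - p j)‖ with hσ
  have hσ0 : 0 ≤ σ := Finset.sum_nonneg fun _ _ => norm_nonneg _
  -- Cauchy–Schwarz over the `q` starting errors; the nonnegative `W` terms are simply added.
  have hσ2 : σ ^ 2 ≤ q * ∑ j ∈ Finset.range q,
      (‖S.emb (𝔭 (j * τ) - p j)‖ ^ 2 + τ * ‖𝔭 (j * τ) - p j‖ ^ 2) := by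
    have h := sq_sum_le_card_mul_sum_sq (s := Finset.range q)
      (f := fun j : ℕ => ‖S.emb (𝔭 (j * τ) - p j)‖)
    rw [Finset.card_range] at h
    refine h.trans (mul_le_mul_of_nonneg_left (Finset.sum_le_sum fun j _ => ?_) (by positivity))
    have : 0 ≤ τ * ‖𝔭 (j * τ) - p j‖ ^ 2 := by positivity
    linarith
  set Q := ∑ j ∈ Finset.range q,
      (‖S.emb (𝔭 (j * τ) - p j)‖ ^ 2 + τ * ‖𝔭 (j * τ) - p j‖ ^ 2) with hQ
  have hQ0 : 0 ≤ Q := Finset.sum_nonneg fun _ _ => by positivity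
  -- `N + 1 ≤ 2N` and `Nτ = T`: accumulation over all steps turns `τ^{q+1}` into `τ^q`.
  have hsteps : (N + 1) * (D * τ ^ (q + 1)) ≤ 2 * T * D * τ ^ q := by
    have h1 : (1 : ℝ) ≤ N := by exact_mod_cast hN
    calc ((N : ℝ) + 1) * (D * τ ^ (q + 1)) ≤ (2 * N) * (D * τ ^ (q + 1)) :=
          mul_le_mul_of_nonneg_right (by linarith) (by positivity)
      _ = 2 * (N * τ) * D * τ ^ q := by ring
      _ = _ := by rw [hNT]
  have hfinal : ‖S.emb (𝔭 (n * τ) - p n)‖ ≤ C * (2 * T * D * τ ^ q + σ) :=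
    herr.trans (mul_le_mul_of_nonneg_left (by linarith) hC.le)
  calc ‖S.emb (𝔭 (n * τ) - p n)‖ ^ 2 ≤ (C * (2 * T * D * τ ^ q + σ)) ^ 2 :=
        pow_le_pow_left₀ (norm_nonneg _) hfinal 2
    _ ≤ C ^ 2 * (2 * ((2 * T * D * τ ^ q) ^ 2 + σ ^ 2)) := by
        rw [mul_pow]
        exact mul_le_mul_of_nonneg_left (add_sq_le) (by positivity)
    _ ≤ C ^ 2 * (2 * ((2 * T * D * τ ^ q) ^ 2 + q * Q)) := by gcongr
    _ = 2 * C ^ 2 * (2 * T * D) ^ 2 * τ ^ (2 * q) + 2 * C ^ 2 * q * Q := by ring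
    _ ≤ _ := by
        have h1 : 0 ≤ 2 * C ^ 2 * q * τ ^ (2 * q) := by positivity
        have h2 : 0 ≤ 2 * C ^ 2 * (2 * T * D) ^ 2 * Q := by positivity
        nlinarith
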